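/- **Notation.** Let $\mathbb F_q$ be a finite field with $q$ elements, $A=\mathbb F_q[\theta]$, $k=\mathbb F_q(\theta)$. Let $v$ be a finite place of $k$ (a monic irreducible polynomial of $A$), $q_v=\#(A/vA)$, $k_v$ the completion of $k$ at $v$ with valuation ring $A_v$ and maximal ideal $\mathfrak m_v$, and $\mathrm{ord}_v$ the valuation with $\mathrm{ord}_v(v)=1$ and $\mathrm{ord}_v(0)=\infty$. An index is a tuple $\mathfrak s=(s_1,\dots,s_r)$ of positive integers with $r\ge 1$; put $\mathrm{wt}(\mathfrak s)=s_1+\dots+s_r$, $\mathrm{dep}(\mathfrak s)=r$, $\mathrm{ht}(\mathfrak s)=\#\{i: s_i\ne 1\}$. Let $[i]=\theta^{q^i}-\theta$, $D_0=1$, $D_i=\prod_{j=1}^{i}[j]^{q^{i-j}}$; for $n=\sum_j n_jq^j$ with $0\le n_j\le q-1$ let $\Gamma_{n+1}=\prod_j D_j^{n_j}$, and let $\Gamma_{\mathfrak s}=\Gamma_{s_1}\cdots\Gamma_{s_r}$. **Polylogarithms.** For an index $\mathfrak s$ and $\mathbf u=(u_1,\dots,u_r)\in A^r$ put $d_\ell=s_\ell+\dots+s_r$,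 $d=d_1+\dots+d_r$. Let $G_{\mathfrak s,\mathbf u}$ be the $d$-dimensional $t$-module with $\rho_t=\theta I_d+N+E\tau$ ($\tau$ the $q$-th power map), where $N=\mathrm{diag}(N_1,\dots,N_r)$, $N_\ell$ is the $d_\ell\times d_\ell$ matrix with ones on the superdiagonal and zeros elsewhere, and $E$ is block upper triangular, its $(\ell,m)$ block ($\ell\le m$, of size $d_\ell\times d_m$) having lower left entry $(-1)^{m-\ell}\prod_{e=\ell}^{m-1}u_e$ and zeros elsewhere. For $a\in\mathbb F_q[t]$ let $\rho_a$ be the image of $a$ under the $\mathbb F_q$-algebra homomorphism sending $t$ to $\rho_t$. Let $\mathbf v_{\mathfrak s,\mathbf u}\in A^d$ have $(-1)^{r-\ell}u_\ell\cdots u_r$ as the last entry of its $\ell$-th block (of length $d_\ell$) and zeros elsewhere. Let $\exp_G=\sum_{i\ge0}Q_i\tau^i$ be the unique series over $k$ with $Q_0=I_d$ and $\exp_G\circ(\theta I_d+N)=\rho_t\circ\exp_G$, and $\log_G=\sum_{i\ge 0}P_i\tau^i$ its formal inverse. With $\tilde{\mathfrak s}=(s_r,\dots,s_1)$, $\tilde{\mathbf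 u}=(u_r,\dots,u_1)$, $G=G_{\tilde{\mathfrak s},\tilde{\mathbf u}}$ and any $0\ne a(t)\in\mathbb F_q[t]$ such that all coordinates of $\rho_a(\mathbf v_{\tilde{\mathfrak s},\tilde{\mathbf u}})$ lie in $\mathfrak m_v$ (such $a$ exist), define $$\mathrm{Li}^\star_{\mathfrak s}(\mathbf u)_v=\frac{(-1)^{r-1}}{a(\theta)}\times\text{ the }(s_1+\dots+s_r)\text{-th coordinate of }\log_G\big(\rho_a(\mathbf v_{\tilde{\mathfrak s},\tilde{\mathbf u}})\big)\in k_v,$$ which does not depend on the choice of $a$. **$v$-adic multiple zeta values.** Let $F_0=1$, $F_i=\prod_{j=1}^{i}(t^{q^i}-\theta^{q^j})$, and define $H_n\in A[t]$ by $$\Big(1-\sum_{i\ge0}\frac{F_i}{D_i|_{\theta=t}}x^{q^i}\Big)^{-1}=\sum_{n\ge0}\frac{H_n}{\Gamma_{n+1}|_{\theta=t}}x^n .$$ Given $\mathfrak s$, write $H_{s_i-1}=\sum_{j=0}^{m_i}u_{ij}t^j$ with $u_{ij}\in A$, $m_i=\deg_t H_{s_i-1}$, and let $J_{\mathfrak s}=\prod_{i=1}^r\{0,\dots,m_i\}$.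 For $\mathbf j\in J_{\mathfrak s}$ put $\mathbf u_{\mathbf j}=(u_{1j_1},\dots,u_{rj_r})$. For $\mathbf w\in\{0,1\}^{r-1}$ let $\mathbf w(\mathfrak s)$ be obtained from $(s_1,\dots,s_r)$ by replacing the $i$-th comma by $+$ whenever $\mathbf w_i=1$, and let $\mathbf w^\times(\mathbf u_{\mathbf j})$ be obtained from $\mathbf u_{\mathbf j}$ by replacing the $i$-th comma by $\times$ whenever $\mathbf w_i=1$. Define $$\zeta_A(\mathfrak s)_v=\frac1{\Gamma_{\mathfrak s}}\sum_{\mathbf j\in J_{\mathfrak s}}\ \sum_{\mathbf w\in\{0,1\}^{r-1}}(-1)^{r-1}\theta^{j_1+\dots+j_r}(-1)^{\mathrm{dep}(\mathbf w(\mathfrak s))-1}\,\mathrm{Li}^\star_{\mathbf w(\mathfrak s)}(\mathbf w^\times(\mathbf u_{\mathbf j}))_v\in k_v .$$ **Theorem.** Let $\mathfrak s$ be an index. For every finite place $v$ of $k$, with $B_{w,v}=\min_{n\ge0}\{q_v^n-n\,w\}$, $$\mathrm{ord}_v(\zeta_A(\mathfrak s)_v)\ \ge\ B_{\mathrm{wt}(\mathfrak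 s),v}-\frac{\mathrm{wt}(\mathfrak s)-\mathrm{dep}(\mathfrak s)-\mathrm{ht}(\mathfrak s)}{q_v-1}.$$ In particular, $\zeta_A(\mathfrak s)_v\in A_v$ for every $v$ with $q_v\ge\mathrm{wt}(\mathfrak s)$, and hence $\zeta_A(\mathfrak s)_v\in A_v$ for all but finitely many $v$. -/

import Mathlib

open Polynomial IsDedekindDomain

namespace VadicMZV

noncomputable section

/-! ### The basic objects of the arithmetic of `A = 𝔽_q[θ]`

`F` is the finite field `𝔽_q`, `F[X]` is `A` (with `X = θ`), and `RatFunc F` is `k`.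
A finite place `v` of `k` is an element of `HeightOneSpectrum F[X]`. -/

section Carlitz

variable (F : Type*) [Field F] [Fintype F]

/-- `[i] = θ^{q^i} - θ`. -/
def bracket (i : ℕ) : F[X] := X ^ (Fintype.card F ^ i) - X

/-- `D_i = [i] [i-1]^q ⋯ [1]^{q^{i-1}}`, `D_0 = 1`. -/
def carlitzD (i : ℕ) : F[X] :=
  ∏ j ∈ Finset.range i, bracket F (j + 1) ^ (Fintype.card F ^ (i - 1 - j))

/-- `carlitzGammaSucc F n` is the Carlitz factorial `Γ_{n+1} = ∏_j D_j^{n_j}`, where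
`n = ∑_j n_j q^j` is the base `q` expansion, so `n_j = ⌊n / q^j⌋ mod q`
(and `n_j = 0` for `j > n`). -/
def carlitzGammaSucc (n : ℕ) : F[X] :=
  ∏ j ∈ Finset.range (n + 1), carlitzD F j ^ (n / Fintype.card F ^ j % Fintype.card F)

/-- `Γ_𝔰 = Γ_{s_1} ⋯ Γ_{s_r}` for an index of positive integers. -/
def carlitzGammaIndex {r : ℕ} (s : Fin r → ℕ) : F[X] := ∏ i, carlitzGammaSucc F (s i - 1)

lemma one_lt_q : 1 < Fintype.card F := Fintype.one_lt_card

lemma bracket_ne_zero (i : ℕ) : bracket F (i + 1) ≠ 0 :=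
  FiniteField.X_pow_card_pow_sub_X_ne_zero F (Nat.succ_ne_zero i) (one_lt_q F)

lemma carlitzD_ne_zero (i : ℕ) : carlitzD F i ≠ 0 :=
  Finset.prod_ne_zero_iff.2 fun _ _ => pow_ne_zero _ (bracket_ne_zero F _)

lemma carlitzGammaSucc_ne_zero (n : ℕ) : carlitzGammaSucc F n ≠ 0 :=
  Finset.prod_ne_zero_iff.2 fun _ _ => pow_ne_zero _ (carlitzD_ne_zero F _)

lemma carlitzD_succ (i : ℕ) :
    carlitzD F (i + 1) = bracket F (i + 1) * carlitzD F i ^ Fintype.card F := by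
  unfold carlitzD
  rw [Finset.prod_range_succ, ← Finset.prod_pow, mul_comm]
  congr 1
  · simp
  · refine Finset.prod_congr rfl fun j hj => ?_
    rw [← pow_mul, ← pow_succ]
    congr 2
    have := Finset.mem_range.1 hj
    omega

/-- The product defining the Carlitz factorial may be taken over any larger range. -/
lemma carlitzGammaSucc_eq {n m : ℕ} (h : n ≤ m) :
    carlitzGammaSucc F n =
      ∏ j ∈ Finset.range (m + 1), carlitzD F j ^ (n / Fintype.card F ^ j % Fintype.card F) := by
  unfold carlitzGammaSucc
  refine Finset.prod_subset (Finset.range_mono (by omega)) fun j _ hj => ?_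
  have hj' : n < j := by simpa using hj
  rw [Nat.div_eq_of_lt (hj'.trans (Nat.lt_pow_self (one_lt_q F)))]
  simp

/-- Carry argument behind the divisibility `D_i Γ_{m+1} ∣ Γ_{m+q^i+1}`. -/
lemma digit_prod_dvd {R : Type*} [CommRing R] {q : ℕ} (hq : 1 < q) (N : ℕ) :
    ∀ (D : ℕ → R), (∀ j, D j ^ q ∣ D (j + 1)) → ∀ i m : ℕ, m + q ^ i < q ^ N →
      D i * ∏ j ∈ Finset.range N, D j ^ (m / q ^ j % q) ∣
        ∏ j ∈ Finset.range N, D j ^ ((m + q ^ i) / q ^ j % q) := by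
  have hq0 : 0 < q := by omega
  induction N with
  | zero =>
    intro D _ i m h
    have : 0 < q ^ i := by positivity
    simp at h
    omega
  | succ N ih =>
    intro D hD i m h
    have key : ∀ n, ∏ j ∈ Finset.range (N + 1), D j ^ (n / q ^ j % q) =
        (∏ j ∈ Finset.range N, D (j + 1) ^ (n / q / q ^ j % q)) * D 0 ^ (n % q) := by
      intro n
      rw [Finset.prod_range_succ']
      simp [Nat.div_div_eq_div_mul, pow_succ']
    rw [key, key]
    have ih' := ih (fun j => D (j + 1)) (fun j => hD (j + 1))
    cases i with
    | succ k =>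
      have h1 : (m + q ^ (k + 1)) / q = m / q + q ^ k := by
        rw [pow_succ, Nat.add_mul_div_right _ _ hq0]
      have h2 : (m + q ^ (k + 1)) % q = m % q := by
        rw [pow_succ, Nat.add_mul_mod_self_right]
      rw [h1, h2, ← mul_assoc]
      refine mul_dvd_mul_right (ih' k (m / q) ?_) _
      rw [← h1]
      exact Nat.div_lt_of_lt_mul (by rw [← pow_succ']; exact h)
    | zero =>
      have hm := Nat.div_add_mod m q
      have hlt := Nat.mod_lt m hq0
      by_cases hc : m % q + 1 < q
      · have h1 : (m + q ^ 0) / q = m / q := by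
          rw [pow_zero]
          conv_lhs => rw [← hm, add_assoc, Nat.mul_add_div hq0, Nat.div_eq_of_lt hc, add_zero]
        have h2 : (m + q ^ 0) % q = m % q + 1 := by
          rw [pow_zero, Nat.add_mod, Nat.mod_eq_of_lt hq, Nat.mod_eq_of_lt hc]
        rw [h1, h2, pow_succ]
        exact dvd_of_eq (by ring)
      · have hc' : m % q = q - 1 := by omega
        have h0 : m + q ^ 0 = q * (m / q + 1) := by
          rw [pow_zero, mul_add]
          omega
        have h1 : (m + q ^ 0) / q = m / q + q ^ 0 := by
          rw [h0, Nat.mul_div_cancel_left _ hq0, pow_zero]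
        have h2 : (m + q ^ 0) % q = 0 := by rw [h0, Nat.mul_mod_right]
        have h3 : m / q + q ^ 0 < q ^ N := by
          rw [← h1]
          exact Nat.div_lt_of_lt_mul (by rw [← pow_succ']; exact h)
        rw [h1, h2, hc', pow_zero (D 0), mul_one]
        refine dvd_trans ?_ (ih' 0 (m / q) h3)
        have h4 : D 0 * ((∏ j ∈ Finset.range N, D (j + 1) ^ (m / q / q ^ j % q)) *
            D 0 ^ (q - 1)) =
            D 0 ^ q * ∏ j ∈ Finset.range N, D (j + 1) ^ (m / q / q ^ j % q) := by
          obtain ⟨p, rfl⟩ : ∃ p, q = p + 1 := ⟨q - 1, by omega⟩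
          simp only [Nat.add_sub_cancel]
          ring
        rw [h4]
        exact mul_dvd_mul_right (hD 0) _

lemma carlitzD_mul_gamma_dvd (i m : ℕ) :
    carlitzD F i * carlitzGammaSucc F m ∣ carlitzGammaSucc F (m + Fintype.card F ^ i) := by
  rw [carlitzGammaSucc_eq F (le_refl (m + Fintype.card F ^ i)),
    carlitzGammaSucc_eq F (Nat.le_add_right m (Fintype.card F ^ i))]
  refine digit_prod_dvd (one_lt_q F) _ (carlitzD F)
    (fun j => ⟨bracket F (j + 1), by rw [carlitzD_succ, mul_comm]⟩) i m ?_
  exact (Nat.lt_succ_self _).trans (Nat.lt_pow_self (one_lt_q F))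

end Carlitz

/-! ### Anderson-Thakur polynomials

Elements of `A[t]` are polynomials over `F[X]`: the outer variable is `t`, and `C X` is `θ`. -/

section AndersonThakur

/-- The specialization `f(θ) ↦ f|_{θ = t}` from `𝔽_q[θ]` to `𝔽_q[t] ⊆ A[t]`. -/
def thetaToT (F : Type*) [Field F] (f : F[X]) : F[X][X] := f.map C

lemma thetaToT_ne_zero (F : Type*) [Field F] {f : F[X]} (hf : f ≠ 0) :
    algebraMap F[X][X] (FractionRing F[X][X]) (thetaToT F f) ≠ 0 := by
  rw [Ne, FaithfulSMul.algebraMap_eq_zero_iff, thetaToT,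
    Polynomial.map_eq_zero_iff (C_injective)]
  exact hf

variable (F : Type*) [Field F] [Fintype F]

/-- `F_i = ∏_{j=1}^{i} (t^{q^i} - θ^{q^j})`, `F_0 = 1`. -/
def atF (i : ℕ) : F[X][X] :=
  ∏ j ∈ Finset.range i, (X ^ (Fintype.card F ^ i) - C (X ^ (Fintype.card F ^ (j + 1))))

/-- The series `∑_{i ≥ 0} (F_i / D_i|_{θ = t}) x^{q^i}` with coefficients in `Frac(A[t])`. -/
def atSeries : PowerSeries (FractionRing F[X][X]) :=
  PowerSeries.mk fun m => ∑ i ∈ Finset.range (m + 1),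
    if m = Fintype.card F ^ i then
      algebraMap F[X][X] (FractionRing F[X][X]) (atF F i) /
        algebraMap F[X][X] (FractionRing F[X][X]) (thetaToT F (carlitzD F i))
    else 0

/-- The coefficients of `(1 - ∑ (F_i / D_i|_{θ=t}) x^{q^i})⁻¹`, multiplied by `Γ_{n+1}|_{θ=t}`,
are polynomials. -/
lemma exists_andersonThakur (n : ℕ) : ∃ H : F[X][X],
    PowerSeries.coeff n (1 - atSeries F)⁻¹ =
      algebraMap F[X][X] (FractionRing F[X][X]) H /
        algebraMap F[X][X] (FractionRing F[X][X]) (thetaToT F (carlitzGammaSucc F n)) := by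
  have h0 : PowerSeries.constantCoeff (1 - atSeries F) ≠ 0 := by
    rw [map_sub, map_one, ← PowerSeries.coeff_zero_eq_constantCoeff_apply, atSeries,
      PowerSeries.coeff_mk, Finset.sum_eq_zero]
    · simp
    · intro i _
      rw [if_neg]
      exact (pow_pos Fintype.card_pos i).ne
  have hrec : (1 - atSeries F)⁻¹ = 1 + atSeries F * (1 - atSeries F)⁻¹ := by
    have := PowerSeries.mul_inv_cancel _ h0
    rw [sub_mul, one_mul] at this
    exact sub_eq_iff_eq_add.1 this
  induction n using Nat.strong_induction_on with
  | _ n ih =>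
  have hG := thetaToT_ne_zero F (carlitzGammaSucc_ne_zero F n)
  suffices h : algebraMap F[X][X] (FractionRing F[X][X])
      (thetaToT F (carlitzGammaSucc F n)) * PowerSeries.coeff n (1 - atSeries F)⁻¹ ∈
        (algebraMap F[X][X] (FractionRing F[X][X])).range by
    obtain ⟨H, hH⟩ := h
    exact ⟨H, by rw [hH, mul_div_cancel_left₀ _ hG]⟩
  rw [hrec, map_add, mul_add, PowerSeries.coeff_mul, Finset.mul_sum]
  refine Subring.add_mem _ ?_ (Subring.sum_mem _ fun ab hab => ?_)
  · rw [PowerSeries.coeff_one]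
    split_ifs
    · exact ⟨_, (mul_one _).symm⟩
    · rw [mul_zero]
      exact Subring.zero_mem _
  · obtain ⟨a, b⟩ := ab
    have hab' : a + b = n := Finset.HasAntidiagonal.mem_antidiagonal.1 hab
    dsimp only
    rw [atSeries, PowerSeries.coeff_mk, Finset.sum_mul, Finset.mul_sum]
    refine Subring.sum_mem _ fun i _ => ?_
    split_ifs with hi
    · have hpos : 0 < Fintype.card F ^ i := pow_pos Fintype.card_pos i
      obtain ⟨H, hH⟩ := ih b (by omega)
      rw [show (1 - PowerSeries.mk _ : PowerSeries (FractionRing F[X][X])) = 1 - atSeries F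
        from rfl, hH]
      obtain ⟨c, hc⟩ := carlitzD_mul_gamma_dvd F i b
      have hn : n = b + Fintype.card F ^ i := by omega
      have hD := thetaToT_ne_zero F (carlitzD_ne_zero F i)
      have hb := thetaToT_ne_zero F (carlitzGammaSucc_ne_zero F b)
      refine ⟨thetaToT F c * atF F i * H, ?_⟩
      rw [hn, hc]
      have hmul : thetaToT F (carlitzD F i * carlitzGammaSucc F b * c) =
          thetaToT F (carlitzD F i) * thetaToT F (carlitzGammaSucc F b) * thetaToT F c := by
        simp [thetaToT, Polynomial.map_mul]
      rw [hmul]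
      simp only [map_mul]
      field_simp
    · rw [zero_mul, mul_zero]
      exact Subring.zero_mem _

/-- The Anderson-Thakur polynomial `H_n ∈ A[t]`, determined by
`(1 - ∑_i (F_i / D_i|_{θ=t}) x^{q^i})⁻¹ = ∑_n (H_n / Γ_{n+1}|_{θ=t}) x^n`. -/
def andersonThakur (n : ℕ) : F[X][X] := (exists_andersonThakur F n).choose

end AndersonThakur

/-! ### The `t`-module `G_{𝔰,𝐮}` -/

section TModule

/-- `d_ℓ = s_ℓ + ⋯ + s_r`. -/
def blockDim {r : ℕ} (s : Fin r → ℕ) (l : Fin r) : ℕ := ∑ e ∈ Finset.Ici l, s e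

/-- The `d = d_1 + ⋯ + d_r` coordinates, arranged in `r` blocks: `⟨ℓ, j⟩` is the `(j+1)`-st
coordinate of the block of size `d_ℓ`. -/
abbrev Coord {r : ℕ} (s : Fin r → ℕ) : Type := Σ l : Fin r, Fin (blockDim s l)

/-- The matrix `N = diag(N_1, …, N_r)`, each `N_ℓ` having ones on the superdiagonal. -/
def matN (R : Type*) [CommRing R] {r : ℕ} (s : Fin r → ℕ) : Matrix (Coord s) (Coord s) R :=
  fun p p' => if p.1 = p'.1 ∧ (p.2 : ℕ) + 1 = p'.2 then 1 else 0

/-- The matrix `E = (E[ℓ m])`: for `ℓ ≤ m` the lower left corner of the block `E[ℓ m]` is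
`(-1)^{m-ℓ} ∏_{e=ℓ}^{m-1} u_e`, and all other entries vanish. -/
def matE {R : Type*} [CommRing R] {r : ℕ} (s : Fin r → ℕ) (u : Fin r → R) :
    Matrix (Coord s) (Coord s) R :=
  fun p p' =>
    if p.1 ≤ p'.1 ∧ (p.2 : ℕ) + 1 = blockDim s p.1 ∧ (p'.2 : ℕ) = 0 then
      (-1) ^ ((p'.1 : ℕ) - p.1) * ∏ e ∈ Finset.Ico p.1 p'.1, u e
    else 0

/-- The special point `𝐯_{𝔰,𝐮}`: the last coordinate of the `ℓ`-th block is
`(-1)^{r-ℓ} u_ℓ ⋯ u_r`, all other coordinates vanish. -/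
def specialPoint {R : Type*} [CommRing R] {r : ℕ} (s : Fin r → ℕ) (u : Fin r → R) : Coord s → R :=
  fun p => if (p.2 : ℕ) + 1 = blockDim s p.1 then
    (-1) ^ (r - 1 - (p.1 : ℕ)) * ∏ e ∈ Finset.Ici p.1, u e else 0

variable {F : Type*} [Field F] [Fintype F]

/-- `ρ_t = θ I_d + N + E τ` acting on the `A`-valued points of `G_{𝔰,𝐮}`, for `𝐮 ∈ A^r`. -/
def rhoT {r : ℕ} (s : Fin r → ℕ) (u : Fin r → F[X]) : Module.End F (Coord s → F[X]) where
  toFun x := (X : F[X]) • x + (matN F[X] s).mulVec x +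
    (matE s u).mulVec fun p => x p ^ Fintype.card F
  map_add' x y := by
    have h : (fun p => (x + y) p ^ Fintype.card F) =
        (fun p => x p ^ Fintype.card F) + fun p => y p ^ Fintype.card F :=
      funext fun p => map_add (FiniteField.frobeniusAlgHom F F[X]) (x p) (y p)
    rw [h, smul_add, Matrix.mulVec_add, Matrix.mulVec_add]
    abel
  map_smul' c x := by
    have h : (fun p => (c • x) p ^ Fintype.card F) = c • fun p => x p ^ Fintype.card F :=
      funext fun p => map_smul (FiniteField.frobeniusAlgHom F F[X]) c (x p)
    rw [h, Matrix.mulVec_smul, Matrix.mulVec_smul, RingHom.id_apply, smul_add, smul_add,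
      smul_comm c (X : F[X]) x]

/-- The `𝔽_q`-linear ring homomorphism `a ↦ ρ_a` from `𝔽_q[t]`, on `A`-valued points. Here
`𝔽_q[t]` is again represented by `F[X]`, with `X = t`. -/
def rho {r : ℕ} (s : Fin r → ℕ) (u : Fin r → F[X]) : F[X] →ₐ[F] Module.End F (Coord s → F[X]) :=
  Polynomial.aeval (rhoT s u)

end TModule

/-! ### Exponential and logarithm of `G_{𝔰,𝐮}` -/

section ExpLog

variable {K ι : Type*} [Field K] [Fintype ι] [DecidableEq ι]

/-- A power series `∑ P_i τ^i` with matrix coefficients is given by the sequence `P`. This is the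
product of such series, with the rule `τ M = M^{(1)} τ`, where `M^{(i)}` has the entries of `M`
raised to the power `q^i`. -/
def twMul (q : ℕ) (P Q : ℕ → Matrix ι ι K) : ℕ → Matrix ι ι K :=
  fun n => ∑ i ∈ Finset.range (n + 1), P i * (Q (n - i)).map (· ^ q ^ i)

/-- The series `M τ^0`. -/
def twConst (M : Matrix ι ι K) : ℕ → Matrix ι ι K := fun n => if n = 0 then M else 0

/-- The series `M_0 + M_1 τ`. -/
def twLinear (M₀ M₁ : Matrix ι ι K) : ℕ → Matrix ι ι K :=
  fun n => if n = 0 then M₀ else if n = 1 then M₁ else 0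

/-- The left inverse, in the ring of twisted power series, of a series with constant term `1`
(see `twMul_twInv`). -/
def twInv (q : ℕ) (Q : ℕ → Matrix ι ι K) : ℕ → Matrix ι ι K
  | 0 => 1
  | n + 1 => -∑ i : Fin (n + 1), twInv q Q i * (Q (n + 1 - i)).map (· ^ q ^ (i : ℕ))
termination_by n => n
decreasing_by exact i.2

lemma twMul_twInv (q : ℕ) (Q : ℕ → Matrix ι ι K) (hQ : Q 0 = 1) (hq : q ≠ 0) :
    twMul q (twInv q Q) Q = twConst 1 := by
  have h1 : ∀ i, (1 : Matrix ι ι K).map (· ^ q ^ i) = 1 := fun i =>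
    Matrix.map_one _ (zero_pow (pow_ne_zero _ hq)) (one_pow _)
  funext n
  cases n with
  | zero => simp [twMul, twConst, twInv, hQ]
  | succ n =>
    simp only [twMul, twConst]
    rw [Finset.sum_range_succ]
    simp only [Nat.sub_self, hQ, h1, mul_one]
    rw [twInv, Finset.sum_range]
    simp

/-- The defining properties of the exponential of a `t`-module with `ρ_t = M₀ + E τ`, so
`∂ρ_t = M₀`: it is `∑ Q_i τ^i` with `Q_0 = I` and `exp ∘ ∂ρ_t = ρ_t ∘ exp`. Since `t` generates
`𝔽_q[t]`, this is the same as `exp ∘ ∂ρ_a = ρ_a ∘ exp` for all `a`. -/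
def IsExp (q : ℕ) (M₀ E : Matrix ι ι K) (Q : ℕ → Matrix ι ι K) : Prop :=
  Q 0 = 1 ∧ twMul q Q (twConst M₀) = twMul q (twLinear M₀ E) Q

lemma existsUnique_isExp {q : ℕ} {θ : K} (hθ : ∀ n, θ ^ q ^ (n + 1) ≠ θ)
    {N E : Matrix ι ι K} (hN : IsNilpotent N)
    (hmap : ∀ i, (θ • (1 : Matrix ι ι K) + N).map (· ^ q ^ i) = θ ^ q ^ i • 1 + N) (hq : q ≠ 0) :
    ∃! Q : ℕ → Matrix ι ι K, IsExp q (θ • 1 + N) E Q := by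
  let S : ℕ → Module.End K (Matrix ι ι K) := fun n =>
    (θ ^ q ^ (n + 1) - θ) • 1 + (LinearMap.mulRight K N - LinearMap.mulLeft K N)
  have hS : ∀ n, IsUnit (S n) := by
    intro n
    have hnil : IsNilpotent (LinearMap.mulRight K N - LinearMap.mulLeft K N) := by
      refine Commute.isNilpotent_sub (LinearMap.commute_mulLeft_right (R := K) N N).symm ?_ ?_
      · obtain ⟨k, hk⟩ := hN
        exact ⟨k, by rw [LinearMap.pow_mulRight, hk, LinearMap.mulRight_zero_eq_zero]⟩
      · obtain ⟨k, hk⟩ := hN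
        exact ⟨k, by rw [LinearMap.pow_mulLeft, hk, LinearMap.mulLeft_zero_eq_zero]⟩
    have hu : IsUnit ((θ ^ q ^ (n + 1) - θ) • (1 : Module.End K (Matrix ι ι K))) := by
      rw [← Algebra.algebraMap_eq_smul_one]
      exact (IsUnit.mk0 _ (sub_ne_zero.2 (hθ n))).map (algebraMap K _)
    refine IsNilpotent.isUnit_add_left_of_commute hnil hu ?_
    exact (Commute.one_right _).smul_right _
  have hS' : ∀ n, Function.Bijective (S n) := fun n => (Module.End.isUnit_iff _).1 (hS n)
  have hSapp : ∀ n M, S n M = M * (θ ^ q ^ (n + 1) • 1 + N) - (θ • 1 + N) * M := by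
    intro n M
    simp only [S, LinearMap.add_apply, LinearMap.smul_apply, LinearMap.sub_apply,
      Module.End.one_apply, LinearMap.mulRight_apply, LinearMap.mulLeft_apply, mul_add, add_mul,
      mul_smul_comm, smul_mul_assoc, mul_one, one_mul, sub_smul]
    abel
  have hz : ∀ i, (0 : Matrix ι ι K).map (· ^ q ^ i) = 0 := fun i =>
    Matrix.map_zero _ (zero_pow (pow_ne_zero _ hq))
  have hexp : ∀ Q : ℕ → Matrix ι ι K, IsExp q (θ • 1 + N) E Q ↔
      Q 0 = 1 ∧ ∀ n, S n (Q (n + 1)) = E * (Q n).map (· ^ q ^ 1) := by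
    intro Q
    refine and_congr_right fun h0 => ?_
    have hl : ∀ n, twMul q Q (twConst (θ • 1 + N)) n = Q n * (θ ^ q ^ n • 1 + N) := by
      intro n
      simp only [twMul, twConst]
      rw [Finset.sum_range_succ, Finset.sum_eq_zero, zero_add, Nat.sub_self, if_pos rfl, hmap]
      intro i hi
      rw [if_neg (by have := Finset.mem_range.1 hi; omega), hz, mul_zero]
    have hr : ∀ n, twMul q (twLinear (θ • 1 + N) E) Q (n + 1) =
        (θ • 1 + N) * Q (n + 1) + E * (Q n).map (· ^ q ^ 1) := by
      intro n
      simp only [twMul, twLinear]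
      rw [Finset.sum_range_succ', Finset.sum_range_succ', Finset.sum_eq_zero]
      · simp [add_comm]
      · intro i _
        rw [if_neg (by omega), if_neg (by omega), zero_mul]
    constructor
    · intro h n
      rw [hSapp, ← hl, h, hr]
      abel
    · intro h
      funext n
      cases n with
      | zero =>
        rw [hl]
        simp [twMul, twLinear, h0]
      | succ n =>
        rw [hl, hr, ← h, hSapp]
        abel
  let Q₀ : ℕ → Matrix ι ι K := fun n => Nat.rec 1
    (fun n M => Function.surjInv (hS' n).2 (E * M.map (· ^ q ^ 1))) n
  refine ⟨Q₀, (hexp _).2 ⟨rfl, fun n => Function.surjInv_eq (hS' n).2 _⟩, fun Q hQ => ?_⟩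
  obtain ⟨h0, h1⟩ := (hexp Q).1 hQ
  funext n
  induction n with
  | zero => exact h0
  | succ n ih =>
    refine (hS' n).1 ?_
    rw [h1, ih]
    exact (Function.surjInv_eq (hS' n).2 _).symm

lemma isNilpotent_matN (R : Type*) [CommRing R] {r : ℕ} (s : Fin r → ℕ) :
    IsNilpotent (matN R s) := by
  have key : ∀ k, ∀ p p' : Coord s, (p.2 : ℕ) + k ≠ p'.2 → (matN R s ^ k) p p' = 0 := by
    intro k
    induction k with
    | zero =>
      intro p p' h
      rw [pow_zero, Matrix.one_apply_ne]
      rintro rfl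
      exact h rfl
    | succ k ih =>
      intro p p' h
      rw [pow_succ', Matrix.mul_apply]
      refine Finset.sum_eq_zero fun p'' _ => ?_
      by_cases hp : p.1 = p''.1 ∧ (p.2 : ℕ) + 1 = p''.2
      · rw [ih p'' p' (by omega), mul_zero]
      · rw [matN, if_neg hp, zero_mul]
  refine ⟨∑ l, blockDim s l, ?_⟩
  ext p p'
  refine key _ p p' ?_
  have h1 := p'.2.2
  have h2 : blockDim s p'.1 ≤ ∑ l, blockDim s l :=
    Finset.single_le_sum (fun _ _ => Nat.zero_le _) (Finset.mem_univ p'.1)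
  omega

variable (F : Type*) [Field F] [Fintype F]

/-- Existence and uniqueness of the exponential series of `G_{𝔰,𝐮}`. -/
lemma existsUnique_expCoeff {r : ℕ} (s : Fin r → ℕ) (u : Fin r → F[X]) :
    ∃! Q : ℕ → Matrix (Coord s) (Coord s) (RatFunc F),
      IsExp (Fintype.card F) ((RatFunc.X : RatFunc F) • 1 + matN (RatFunc F) s)
        (matE s fun i => algebraMap F[X] (RatFunc F) (u i)) Q := by
  have hq : Fintype.card F ≠ 0 := Fintype.card_ne_zero
  refine existsUnique_isExp (fun n h => ?_) ?_ (fun i => ?_) hq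
  · refine bracket_ne_zero F n ?_
    apply RatFunc.algebraMap_injective F
    simpa [bracket, sub_eq_zero] using h
  · exact isNilpotent_matN _ s
  · ext p p'
    have h0 : (0 : RatFunc F) ^ Fintype.card F ^ i = 0 := zero_pow (pow_ne_zero _ hq)
    by_cases hp : p = p'
    · subst hp
      simp [matN]
    · simp only [Matrix.map_apply, Matrix.add_apply, Matrix.smul_apply, Matrix.one_apply_ne hp,
        smul_zero, zero_add, matN]
      split_ifs
      · exact one_pow _
      · exact h0

/-- The coefficients `Q_i`, with entries in `k`, of `exp_G = ∑ Q_i τ^i` for `G = G_{𝔰,𝐮}`. -/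
def expCoeff {r : ℕ} (s : Fin r → ℕ) (u : Fin r → F[X]) :
    ℕ → Matrix (Coord s) (Coord s) (RatFunc F) :=
  (existsUnique_expCoeff F s u).choose

/-- The coefficients `P_i`, with entries in `k`, of `log_G = ∑ P_i τ^i` for `G = G_{𝔰,𝐮}`: the
formal inverse of the exponential. -/
def logCoeff {r : ℕ} (s : Fin r → ℕ) (u : Fin r → F[X]) :
    ℕ → Matrix (Coord s) (Coord s) (RatFunc F) :=
  twInv (Fintype.card F) (expCoeff F s u)

end ExpLog

/-! ### `v`-adic Carlitz multiple star polylogarithms -/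

section StarLog

variable {F : Type*} [Field F] [Fintype F] (v : HeightOneSpectrum F[X])

/-- The value `log_G(x) = ∑_i P_i x^{(i)}` for `G = G_{𝔰,𝐮}` and `x` with coordinates in `k_v`
(used only where the series converges). -/
def logG {r : ℕ} (s : Fin r → ℕ) (u : Fin r → F[X]) (x : Coord s → v.adicCompletion (RatFunc F)) :
    Coord s → v.adicCompletion (RatFunc F) :=
  fun p => ∑' i : ℕ, ∑ p', algebraMap (RatFunc F) (v.adicCompletion (RatFunc F))
    (logCoeff F s u i p p') * x p' ^ Fintype.card F ^ i

/-- `a ∈ 𝔽_q[t]` is nonzero and `ρ_a(𝐯_{𝔰,𝐮})` has all its coordinates in the maximal ideal. -/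
def IsAdmissible {r : ℕ} (s : Fin r → ℕ) (u : Fin r → F[X]) (a : F[X]) : Prop :=
  a ≠ 0 ∧ ∀ p, Valued.v (algebraMap F[X] (v.adicCompletion (RatFunc F))
    (rho s u a (specialPoint s u) p)) < 1

lemma finite_residue : Finite (F[X] ⧸ v.asIdeal) := by
  obtain ⟨f, hf⟩ := IsPrincipalIdealRing.principal v.asIdeal
  have hf0 : f ≠ 0 := by
    rintro rfl
    exact v.ne_bot (by simpa using hf)
  have hfin : Module.Finite F (AdjoinRoot f) := (AdjoinRoot.powerBasis hf0).finite
  have : Finite (AdjoinRoot f) := Module.finite_of_finite F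
  rw [hf]
  exact this

lemma exists_isAdmissible {r : ℕ} (s : Fin r → ℕ) (u : Fin r → F[X]) :
    ∃ a, IsAdmissible v s u a := by
  have := finite_residue v
  let Φ : F[X] → Coord s → F[X] ⧸ v.asIdeal := fun a p =>
    Ideal.Quotient.mk v.asIdeal (rho s u a (specialPoint s u) p)
  have hΦ : ¬ Function.Injective Φ := not_injective_infinite_finite Φ
  obtain ⟨a, b, hab, hne⟩ : ∃ a b, Φ a = Φ b ∧ a ≠ b := by
    simpa [Function.Injective] using hΦ
  refine ⟨a - b, sub_ne_zero.2 hne, fun p => ?_⟩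
  have h := Ideal.Quotient.eq.1 (congrFun hab p)
  rw [map_sub, LinearMap.sub_apply, Pi.sub_apply]
  exact (HeightOneSpectrum.valuedAdicCompletion_eq_valuation v _).trans_lt
    ((HeightOneSpectrum.valuation_lt_one_iff_mem v _).2 h)

/-- The `v`-adic Carlitz multiple star polylogarithm `Li⋆_𝔰(𝐮)_v` for `𝐮 ∈ A^r`. With
`𝔰~ = (s_r, …, s_1)`, `𝐮~ = (u_r, …, u_1)`, it is `(-1)^{r-1} / a(θ)` times the `d~_1`-th
coordinate (the last one of the first block) of `log_G(ρ_a(𝐯))`, where `G = G_{𝔰~,𝐮~}`,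
`𝐯 = 𝐯_{𝔰~,𝐮~}`, and `a` is any nonzero polynomial with `ρ_a(𝐯) ∈ G(𝔪_v)`; the value does not
depend on `a`. The sum below has exactly one term. -/
def starLi {r : ℕ} (s : Fin r → ℕ) (u : Fin r → F[X]) : v.adicCompletion (RatFunc F) :=
  let s' := s ∘ Fin.rev
  let u' := u ∘ Fin.rev
  let a : F[X] := (exists_isAdmissible v s' u').choose
  (-1) ^ (r - 1) / algebraMap F[X] (v.adicCompletion (RatFunc F)) a *
    ∑ p : Coord s' with (p.1 : ℕ) = 0 ∧ (p.2 : ℕ) + 1 = blockDim s' p.1,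
      logG v s' u' (fun p' => algebraMap F[X] (v.adicCompletion (RatFunc F))
        (rho s' u' a (specialPoint s' u') p')) p

end StarLog

/-! ### `v`-adic multiple zeta values -/

section MZV

/-- For a sequence of signs `𝐰` (`false` is a comma, `true` merges two neighbours) and a list of
pairs `(s_1,u_1), …, (s_r,u_r)`, the list of pairs formed by the entries of `𝐰(𝔰)` and
`𝐰^×(𝐮)`: merging adds the first components and multiplies the second ones. -/
def merge {R : Type*} [Mul R] : List Bool → List (ℕ × R) → List (ℕ × R)
  | false :: w, x :: l => x :: merge w l
  | true :: w, x :: y :: l => merge w ((x.1 + y.1, x.2 * y.2) :: l)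
  | _, l => l

variable {F : Type*} [Field F] [Fintype F] (v : HeightOneSpectrum F[X])

/-- The `v`-adic multiple zeta value
`ζ_A(𝔰)_v = Γ_𝔰⁻¹ ∑_{𝐣 ∈ J_𝔰} ∑_{𝐰 ∈ {0,1}^{r-1}} b · (-1)^{dep(𝐰(𝔰)) - 1} Li⋆_{𝐰(𝔰)}(𝐰^×(𝐮_𝐣))_v`
with `b = (-1)^{r-1} θ^{j_1 + ⋯ + j_r}` and `𝐮_𝐣 = (u_{1 j_1}, …, u_{r j_r})`, `u_{ij}` being the
coefficient of `t^j` in `H_{s_i - 1}`, and `J_𝔰 = ∏_i {0, …, m_i}`, `m_i = deg_t H_{s_i - 1}`. -/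
def vadicMZV {r : ℕ} (s : Fin r → ℕ) : v.adicCompletion (RatFunc F) :=
  (algebraMap F[X] (v.adicCompletion (RatFunc F)) (carlitzGammaIndex F s))⁻¹ *
    ∑ j ∈ Fintype.piFinset fun i => Finset.range ((andersonThakur F (s i - 1)).natDegree + 1),
      ∑ w : Fin (r - 1) → Bool,
        let L : List (ℕ × F[X]) := merge (List.ofFn w)
          (List.ofFn fun i => (s i, (andersonThakur F (s i - 1)).coeff (j i)))
        algebraMap F[X] (v.adicCompletion (RatFunc F)) ((-1) ^ (r - 1) * X ^ (∑ i, j i)) *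
          (-1) ^ (L.length - 1) * starLi v (fun i => (L.get i).1) (fun i => (L.get i).2)

/-- `wt(𝔰) = s_1 + ⋯ + s_r`. -/
def weight {r : ℕ} (s : Fin r → ℕ) : ℕ := ∑ i, s i

/-- `ht(𝔰)` is the number of `i` with `s_i ≠ 1`. -/
def height {r : ℕ} (s : Fin r → ℕ) : ℕ := Finset.card {i | s i ≠ 1}

/-- `q_v`, the cardinality of the residue field `A / vA`. -/
def qv : ℕ := Nat.card (F[X] ⧸ v.asIdeal)

/-- `B_{w,v} = min_{n ≥ 0} (q_v^n - n w)`; the minimum exists, see `isLeast_boundB`. -/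
def boundB (w : ℕ) : ℤ := ⨅ n : ℕ, ((qv v : ℤ) ^ n - n * w)

lemma isLeast_boundB (w : ℕ) :
    IsLeast (Set.range fun n : ℕ => (qv v : ℤ) ^ n - n * w) (boundB v w) := by
  have hfin := finite_residue v
  have hnt : Nontrivial (F[X] ⧸ v.asIdeal) := Ideal.Quotient.nontrivial_iff.2 v.isPrime.ne_top
  have hq : 2 ≤ qv v := Finite.one_lt_card
  have hbdd : BddBelow (Set.range fun n : ℕ => (qv v : ℤ) ^ n - n * w) := by
    refine ⟨-(w * w : ℤ), ?_⟩
    rintro _ ⟨n, rfl⟩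
    have h1 : n * w ≤ qv v ^ n + w * w := by
      rcases le_total n w with h | h
      · exact (Nat.mul_le_mul_right w h).trans (Nat.le_add_left _ _)
      · obtain ⟨m, rfl⟩ := Nat.exists_eq_add_of_le h
        have hm : m ≤ qv v ^ m := (Nat.lt_pow_self (by omega)).le
        have hw : w ≤ qv v ^ w := (Nat.lt_pow_self (by omega)).le
        have := Nat.mul_le_mul hw hm
        rw [pow_add]
        nlinarith
    have h2 : (n * w : ℤ) ≤ (qv v : ℤ) ^ n + w * w := by exact_mod_cast h1
    change -(w * w : ℤ) ≤ (qv v : ℤ) ^ n - n * w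
    linarith
  exact ⟨Int.csInf_mem (Set.range_nonempty _) hbdd, fun _ h => csInf_le hbdd h⟩

open scoped Classical in
/-- The additive valuation `ord_v` on `k_v`, normalized by `ord_v(v) = 1`, with
`ord_v(0) = ∞`. -/
def ordv (x : v.adicCompletion (RatFunc F)) : WithTop ℚ :=
  if x = 0 then ⊤ else ((-(WithZero.log (Valued.v x)) : ℤ) : ℚ)

end MZV

end

end VadicMZV

set_option linter.unusedSectionVars false

/-! Every term defining ζ_A(𝔰)_v is an integral multiple of a star polylogarithm of weight wt(𝔰),
divided by Γ_𝔰. By the ultrametric inequality it is enough to bound ord_v(Li⋆) from below by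
B_{wt,v} and ord_v(Γ_𝔰) from above by (wt - dep - ht)/(q_v - 1).

Write d for the degree of v. The bound on Γ_𝔰 (`exists_exp_le_valuation_carlitzGammaIndex`) rests on
ord_v([i]) being 1 if d ∣ i and 0 otherwise (i ≥ 1), which controls D_j through D_{j+1} = [j+1]
D_j^q.

For Li⋆, compare coefficients in log ∘ ρ_t = ∂ρ_t ∘ log on the last row of a block, where left
multiplication by N vanishes. Each entry of P_{n+1} is obtained from P_n by at most wt divisions by
[n+1], so ord_v(P_n) ≥ -wt ⌊n/d⌋ (`valuation_logCoeff_le`). At a point of G(𝔪_v) the i-th term of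
the logarithm then has order at least q^i - wt ⌊i/d⌋ ≥ q_v^m - m wt with m = ⌊i/d⌋, hence at least
B_{wt,v} (`valued_logSum_le`).

The division by a(θ) could still spoil this. It does not, because some admissible b is prime to v
(`exists_isAdmissible_notMem`), and the F[t]-linearity `logSum_rho` gives b(θ) log ρ_a(𝐯) = log
ρ_{ab}(𝐯) = a(θ) log ρ_b(𝐯). To find b, let κ = A/v. The polynomial v(t) acts injectively on the
finite group G(κ), so some power v(t)^n with n ≥ 1 acts as the identity; b = v(t)^n - 1 kills G(κ),
and b(θ) ≡ -1 mod v. Injectivity comes from replacing a point by its sequence of Frobenius twists: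
there ρ_t becomes κ-linear, v(t) splits into factors t - θ^{q^j}, and no θ^{q^j} is an eigenvalue on
periodic sequences. -/

namespace VadicMZV

open WithZero Filter Topology

/-! ### Orders of [i], D_j and the Carlitz factorials at a finite place. -/

section Places

variable {F : Type*} [Field F] [Fintype F]

/-- The residue degree of `v` over `𝔽_q`. -/
noncomputable def placeDegree (v : HeightOneSpectrum F[X]) : ℕ := Module.finrank F (F[X] ⧸ v.asIdeal)

variable (v : HeightOneSpectrum F[X])

lemma placeDegree_pos : 0 < placeDegree v := by
  have := finite_residue v
  have : Nontrivial (F[X] ⧸ v.asIdeal) := Ideal.Quotient.nontrivial_iff.2 v.isPrime.ne_top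
  exact Module.finrank_pos

lemma qv_eq : qv v = Fintype.card F ^ placeDegree v := by
  have := finite_residue v
  rw [qv, placeDegree, Module.natCard_eq_pow_finrank (K := F), Nat.card_eq_fintype_card]

lemma two_le_qv : 2 ≤ qv v := by
  rw [qv_eq]
  exact Nat.one_lt_pow (placeDegree_pos v).ne' (one_lt_q F)

/-- The class of θ generates A/v over F, so θ^{q^i} ≡ θ mod v means that the i-th power of Frobenius
is the identity on A/v, and the order of Frobenius is the degree of the residue field. -/
lemma bracket_mem_iff (i : ℕ) : bracket F i ∈ v.asIdeal ↔ placeDegree v ∣ i := by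
  have := finite_residue v
  have := v.isMaximal
  let _ := Ideal.Quotient.field v.asIdeal
  rw [placeDegree, ← FiniteField.orderOf_frobeniusAlgHom F (F[X] ⧸ v.asIdeal),
    orderOf_dvd_iff_pow_eq_one, ← Ideal.Quotient.eq_zero_iff_mem, bracket, map_sub, map_pow,
    sub_eq_zero]
  have key : ∀ x : F[X] ⧸ v.asIdeal,
      (FiniteField.frobeniusAlgHom F (F[X] ⧸ v.asIdeal) ^ i) x = x ^ Fintype.card F ^ i := by
    intro x
    rw [AlgHom.coe_pow, FiniteField.coe_frobeniusAlgHom, pow_iterate]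
  constructor
  · intro h
    have h2 : ((FiniteField.frobeniusAlgHom F (F[X] ⧸ v.asIdeal) ^ i).comp
        (Ideal.Quotient.mkₐ F v.asIdeal)) = Ideal.Quotient.mkₐ F v.asIdeal := by
      refine Polynomial.algHom_ext ?_
      change (FiniteField.frobeniusAlgHom F (F[X] ⧸ v.asIdeal) ^ i) (Ideal.Quotient.mk _ X) =
        Ideal.Quotient.mk _ X
      rw [key]
      exact h
    ext x
    obtain ⟨y, rfl⟩ := Ideal.Quotient.mkₐ_surjective F v.asIdeal x
    exact DFunLike.congr_fun h2 y
  · intro h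
    rw [← key, h, AlgHom.one_apply]

/-- The derivative of [i] is -1, whereas elements of v² have derivative in v: zeros of [i] are
simple. -/
lemma bracket_notMem_sq {i : ℕ} (hi : 0 < i) : bracket F i ∉ v.asIdeal ^ 2 := by
  intro h
  have hder : ∀ x ∈ v.asIdeal ^ 2, derivative x ∈ v.asIdeal := by
    intro x hx
    rw [pow_two] at hx
    refine Submodule.mul_induction_on hx (fun a ha b hb => ?_) fun a b ha hb => ?_
    · rw [derivative_mul]
      exact add_mem (v.asIdeal.mul_mem_left _ hb) (v.asIdeal.mul_mem_right _ ha)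
    · rw [derivative_add]
      exact add_mem ha hb
  have h1 := hder _ h
  rw [bracket, derivative_sub, derivative_X_pow, derivative_X, Nat.cast_pow,
    FiniteField.cast_card_eq_zero, zero_pow hi.ne', map_zero, zero_mul, zero_sub] at h1
  exact v.isPrime.ne_top ((Ideal.eq_top_iff_one _).2 (by simpa using neg_mem h1))

/-- `ord_v([i]) ≤ ⌊i/d⌋ - ⌊(i-1)/d⌋`. -/
lemma exp_le_valuation_bracket (i : ℕ) :
    exp (-(if placeDegree v ∣ i + 1 then 1 else 0 : ℤ)) ≤
      v.intValuation (bracket F (i + 1)) := by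
  split_ifs with h
  · by_contra! hlt
    refine bracket_notMem_sq v (Nat.succ_pos i) ((v.intValuation_le_pow_iff_mem _ 2).1 ?_)
    have h0 : v.intValuation (bracket F (i + 1)) ≠ 0 :=
      v.intValuation_ne_zero _ (bracket_ne_zero F i)
    rw [← exp_log h0] at hlt ⊢
    rw [exp_lt_exp] at hlt
    rw [exp_le_exp]
    push_cast
    omega
  · rw [neg_zero, exp_zero]
    by_contra! hlt
    exact h ((bracket_mem_iff v _).1 ((v.intValuation_lt_one_iff_mem _).1 hlt))

/-- The first clause says ord_v(D_j) ≤ e, the second e(q_v - 1) ≤ q^j - q^(j mod d), written without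
subtraction. In the recursion D_{j+1} = [j+1] D_j^q the term q^(j mod d) is multiplied by q until d
∣ j+1, where q · q^(d-1) = q_v drops to 1; this gain of q_v - 1 pays exactly for the simple zero of
[j+1]. -/
lemma exists_exp_le_valuation_carlitzD (j : ℕ) : ∃ e : ℕ,
    exp (-(e : ℤ)) ≤ v.intValuation (carlitzD F j) ∧
      e * qv v + Fintype.card F ^ (j % placeDegree v) ≤ Fintype.card F ^ j + e := by
  induction j with
  | zero => exact ⟨0, by simp [carlitzD]⟩
  | succ j ih =>
    obtain ⟨e, he, hle⟩ := ih
    set q := Fintype.card F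
    set d := placeDegree v
    have hd : 0 < d := placeDegree_pos v
    refine ⟨(if d ∣ j + 1 then 1 else 0) + q * e, ?_, ?_⟩
    · rw [carlitzD_succ, map_mul, map_pow]
      have h1 : exp (-(((if d ∣ j + 1 then 1 else 0) + q * e : ℕ) : ℤ)) =
          exp (-(if d ∣ j + 1 then 1 else 0 : ℤ)) * exp (-(e : ℤ)) ^ q := by
        rw [← exp_nsmul, ← exp_add]
        congr 1
        push_cast
        rw [nsmul_eq_mul]
        ring
      rw [h1]
      gcongr
      exact exp_le_valuation_bracket v j
    · have hmul := Nat.mul_le_mul_left q hle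
      have hqv : qv v = q ^ d := qv_eq v
      rw [hqv] at hmul ⊢
      split_ifs with h
      · have h1 : (j + 1) % d = 0 := Nat.mod_eq_zero_of_dvd h
        have h2 : j % d + 1 = d := by
          have h3 := Nat.mod_lt j hd
          by_contra hne
          have h4 : (j + 1) % d = j % d + 1 := by
            rw [Nat.add_mod, Nat.mod_eq_of_lt (show 1 < d by omega), Nat.mod_eq_of_lt (by omega)]
          omega
        have h5 : q * q ^ (j % d) = q ^ d := by rw [← pow_succ', h2]
        rw [h1, pow_succ', pow_zero]
        nlinarith
      · have h4 : (j + 1) % d = j % d + 1 := by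
          have h3 := Nat.mod_lt j hd
          have h6 : j % d + 1 ≠ d := fun h7 => h (Nat.dvd_of_mod_eq_zero (by
            rw [Nat.add_mod, ← Nat.mod_add_div 1 d]
            simp [h7]))
          rw [Nat.add_mod, Nat.mod_eq_of_lt (show 1 < d by omega), Nat.mod_eq_of_lt (by omega)]
        rw [h4, pow_succ', pow_succ']
        nlinarith

lemma sum_digits_mul_pow (q n N : ℕ) :
    ∑ j ∈ Finset.range N, n / q ^ j % q * q ^ j = n % q ^ N := by
  induction N with
  | zero => simp [Nat.mod_one]
  | succ N ih => rw [Finset.sum_range_succ, ih, Nat.mod_pow_succ, mul_comm]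

/-- Weighting ord_v(D_j) ≤ (q^j - 1)/(q_v - 1) by the base q digits of n gives n minus its digit
sum, and the digit sum is at least 1 when n ≠ 0. With n = s_i - 1, this extra 1 is what produces the
height in the final bound. -/
lemma exists_exp_le_valuation_carlitzGammaSucc (n : ℕ) : ∃ g : ℕ,
    exp (-(g : ℤ)) ≤ v.intValuation (carlitzGammaSucc F n) ∧
      g * qv v + (if n = 0 then 0 else 1) ≤ n + g := by
  choose e he hle using exists_exp_le_valuation_carlitzD v
  set q := Fintype.card F
  have hq : 1 < q := one_lt_q F
  have hsum : ∑ j ∈ Finset.range (n + 1), n / q ^ j % q * q ^ j = n := by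
    rw [sum_digits_mul_pow, Nat.mod_eq_of_lt]
    exact (Nat.lt_succ_self n).trans (Nat.lt_pow_self hq)
  refine ⟨∑ j ∈ Finset.range (n + 1), n / q ^ j % q * e j, ?_, ?_⟩
  · rw [carlitzGammaSucc, map_prod]
    have : exp (-((∑ j ∈ Finset.range (n + 1), n / q ^ j % q * e j : ℕ) : ℤ)) =
        ∏ j ∈ Finset.range (n + 1), exp (-(e j : ℤ)) ^ (n / q ^ j % q) := by
      induction n + 1 with
      | zero => simp
      | succ N ih =>
        rw [Finset.sum_range_succ, Finset.prod_range_succ, ← ih, ← exp_nsmul, ← exp_add]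
        congr 1
        push_cast
        rw [nsmul_eq_mul]
        push_cast
        ring
    rw [this]
    refine Finset.prod_le_prod' fun j _ => ?_
    rw [map_pow]
    exact pow_le_pow_left' (he j) _
  · have h1 : ∀ j, n / q ^ j % q * e j * qv v + n / q ^ j % q ≤
        n / q ^ j % q * q ^ j + n / q ^ j % q * e j := by
      intro j
      have := hle j
      have h2 : 1 ≤ q ^ (j % placeDegree v) := Nat.one_le_pow _ _ (by omega)
      calc n / q ^ j % q * e j * qv v + n / q ^ j % q
          = n / q ^ j % q * (e j * qv v + 1) := by ring
        _ ≤ n / q ^ j % q * (q ^ j + e j) := Nat.mul_le_mul_left _ (by omega)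
        _ = _ := by ring
    have h2 := Finset.sum_le_sum fun j (_ : j ∈ Finset.range (n + 1)) => h1 j
    rw [Finset.sum_add_distrib, Finset.sum_add_distrib, hsum, ← Finset.sum_mul] at h2
    refine le_trans (Nat.add_le_add_left ?_ _) h2
    split_ifs with hn
    · exact Nat.zero_le _
    · by_contra! hlt
      refine hn (hsum.symm.trans (Finset.sum_eq_zero fun j hj => ?_))
      rw [Finset.sum_eq_zero_iff.1 (Nat.lt_one_iff.1 hlt) j hj, zero_mul]

/-- `ord_v(Γ_𝔰) ≤ (wt(𝔰) - dep(𝔰) - ht(𝔰)) / (q_v - 1)`. -/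
lemma exists_exp_le_valuation_carlitzGammaIndex {r : ℕ} (s : Fin r → ℕ) (hs : ∀ i, 0 < s i) :
    ∃ g : ℕ, exp (-(g : ℤ)) ≤ v.intValuation (carlitzGammaIndex F s) ∧
      (g : ℤ) * (qv v - 1) ≤ weight s - r - height s := by
  choose g hg hle using fun i => exists_exp_le_valuation_carlitzGammaSucc v (s i - 1)
  refine ⟨∑ i, g i, ?_, ?_⟩
  · rw [carlitzGammaIndex, map_prod]
    have : exp (-((∑ i, g i : ℕ) : ℤ)) = ∏ i, exp (-(g i : ℤ)) := by
      have := map_prod (⟨⟨fun x : Multiplicative ℤ => exp (-x.toAdd), by simp⟩,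
        fun x y => by rw [← exp_add]; simp [add_comm]⟩ : Multiplicative ℤ →* ℤᵐ⁰)
        (fun i => Multiplicative.ofAdd (g i : ℤ)) Finset.univ
      simpa [← ofAdd_sum] using this
    rw [this]
    exact Finset.prod_le_prod' fun i _ => hg i
  · have h1 : (weight s : ℤ) - r - height s =
        ∑ i, ((s i : ℤ) - 1 - if s i ≠ 1 then 1 else 0) := by
      simp [weight, height, Finset.sum_sub_distrib, Finset.card_filter]
    rw [h1, Nat.cast_sum, Finset.sum_mul]
    refine Finset.sum_le_sum fun i _ => ?_
    have h2 := hle i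
    have h3 := hs i
    rcases eq_or_ne (s i) 1 with h4 | h4
    · rw [if_neg (not_not.2 h4)]
      simp only [h4, Nat.sub_self, if_true] at h2 ⊢
      zify at h2
      push_cast
      linarith
    · rw [if_pos h4]
      rw [if_neg (by omega)] at h2
      zify [Nat.one_le_iff_ne_zero.2 h3.ne'] at h2
      linarith

end Places

/-! ### The monoid of twisted power series, and log ∘ ρ_t = ∂ρ_t ∘ log. -/

section TwistedSeries

variable {K ι : Type*} [Field K] [Fintype ι] [DecidableEq ι] {q : ℕ}

lemma map_zero_pow_card (hq : q ≠ 0) (i : ℕ) : (0 : Matrix ι ι K).map (· ^ q ^ i) = 0 :=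
  Matrix.map_zero _ (zero_pow (pow_ne_zero _ hq))

lemma map_one_pow_card (hq : q ≠ 0) (i : ℕ) : (1 : Matrix ι ι K).map (· ^ q ^ i) = 1 :=
  Matrix.map_one _ (zero_pow (pow_ne_zero _ hq)) (one_pow _)

lemma map_pow_card_eq (φ : K →+* K) (hφ : ∀ x, φ x = x ^ q) (i : ℕ) (M : Matrix ι ι K) :
    M.map (· ^ q ^ i) = (φ ^ i).mapMatrix M := by
  ext a b
  have : (φ ^ i) (M a b) = M a b ^ q ^ i := by
    rw [RingHom.coe_pow, show (φ : K → K) = (· ^ q) from funext hφ, pow_iterate]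
  exact this.symm

lemma twMul_eq_sum_antidiagonal (P Q : ℕ → Matrix ι ι K) (n : ℕ) :
    twMul q P Q n = ∑ x ∈ Finset.HasAntidiagonal.antidiagonal n, P x.1 * (Q x.2).map (· ^ q ^ x.1) :=
  (Finset.Nat.sum_antidiagonal_eq_sum_range_succ (fun i j => P i * (Q j).map (· ^ q ^ i)) n).symm

/-- Since x ↦ x^q is a ring endomorphism, twists distribute over sums and products of matrices and
compose additively; both sides become the same sum over triples of indices. -/
lemma twMul_assoc (φ : K →+* K) (hφ : ∀ x, φ x = x ^ q) (P Q R : ℕ → Matrix ι ι K) :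
    twMul q (twMul q P Q) R = twMul q P (twMul q Q R) := by
  funext n
  have hcomp : ∀ i j (M : Matrix ι ι K),
      (φ ^ i).mapMatrix ((φ ^ j).mapMatrix M) = (φ ^ (i + j)).mapMatrix M := by
    intro i j M
    ext a b
    simp [pow_add, RingHom.mul_def]
  simp only [twMul_eq_sum_antidiagonal, map_pow_card_eq φ hφ, map_sum, map_mul, Finset.sum_mul,
    Finset.mul_sum, Finset.sum_sigma', hcomp]
  refine Finset.sum_nbij' (fun x => ⟨(x.2.1, x.2.2 + x.1.2), (x.2.2, x.1.2)⟩)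
    (fun x => ⟨(x.1.1 + x.2.1, x.2.2), (x.1.1, x.2.1)⟩) ?_ ?_ ?_ ?_ ?_
  · rintro ⟨⟨i, j⟩, ⟨k, l⟩⟩ h
    simp only [Finset.mem_sigma, Finset.HasAntidiagonal.mem_antidiagonal] at h ⊢
    exact ⟨by omega, trivial⟩
  · rintro ⟨⟨i, j⟩, ⟨k, l⟩⟩ h
    simp only [Finset.mem_sigma, Finset.HasAntidiagonal.mem_antidiagonal] at h ⊢
    exact ⟨by omega, trivial⟩
  · rintro ⟨⟨i, j⟩, ⟨k, l⟩⟩ h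
    simp only [Finset.mem_sigma, Finset.HasAntidiagonal.mem_antidiagonal] at h
    simp [h.2]
  · rintro ⟨⟨i, j⟩, ⟨k, l⟩⟩ h
    simp only [Finset.mem_sigma, Finset.HasAntidiagonal.mem_antidiagonal] at h
    simp [h.2]
  · rintro ⟨⟨i, j⟩, ⟨k, l⟩⟩ h
    simp only [Finset.mem_sigma, Finset.HasAntidiagonal.mem_antidiagonal] at h
    simp only [mul_assoc, h.2]

lemma twConst_mul (M : Matrix ι ι K) (P : ℕ → Matrix ι ι K) (n : ℕ) :
    twMul q (twConst M) P n = M * P n := by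
  rw [twMul, Finset.sum_eq_single 0]
  · simp [twConst]
  · intro i _ hi
    simp [twConst, hi]
  · simp

lemma one_twMul (P : ℕ → Matrix ι ι K) : twMul q (twConst 1) P = P :=
  funext fun n => by rw [twConst_mul, one_mul]

lemma twMul_one (hq : q ≠ 0) (P : ℕ → Matrix ι ι K) : twMul q P (twConst 1) = P := by
  funext n
  rw [twMul, Finset.sum_eq_single n]
  · simp [twConst, map_one_pow_card hq]
  · intro i hi hne
    have := Finset.mem_range.1 hi
    rw [twConst, if_neg (by omega), map_zero_pow_card hq, mul_zero]
  · simp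

lemma twMul_twLinear_succ (hq : q ≠ 0) (P : ℕ → Matrix ι ι K) (M E : Matrix ι ι K) (n : ℕ) :
    twMul q P (twLinear M E) (n + 1) =
      P (n + 1) * M.map (· ^ q ^ (n + 1)) + P n * E.map (· ^ q ^ n) := by
  rw [twMul, Finset.sum_range_succ, Finset.sum_range_succ, Finset.sum_eq_zero, zero_add, add_comm]
  · simp [twLinear]
  · intro i hi
    have := Finset.mem_range.1 hi
    rw [twLinear, if_neg (by omega), if_neg (by omega), map_zero_pow_card hq, mul_zero]

lemma twInv_zero (Q : ℕ → Matrix ι ι K) : twInv q Q 0 = 1 := by rw [twInv]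

/-- The left inverse of Q has constant term 1, so it has a left inverse itself, which by
associativity must be Q. -/
lemma twMul_twInv_right (φ : K →+* K) (hφ : ∀ x, φ x = x ^ q) (hq : q ≠ 0)
    (Q : ℕ → Matrix ι ι K) (hQ : Q 0 = 1) : twMul q Q (twInv q Q) = twConst 1 := by
  have h1 := twMul_twInv q Q hQ hq
  have h2 := twMul_twInv q (twInv q Q) (twInv_zero Q) hq
  have h3 : twInv q (twInv q Q) = Q := by
    have := twMul_assoc φ hφ (twInv q (twInv q Q)) (twInv q Q) Q
    rw [h1, h2, twMul_one hq, one_twMul] at this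
    exact this.symm
  rwa [h3] at h2

/-- The logarithm satisfies `log ∘ ρ_t = ∂ρ_t ∘ log`. -/
lemma IsExp.twInv_mul (φ : K →+* K) (hφ : ∀ x, φ x = x ^ q) (hq : q ≠ 0)
    {M E : Matrix ι ι K} {Q : ℕ → Matrix ι ι K} (h : IsExp q M E Q) :
    twMul q (twInv q Q) (twLinear M E) = twMul q (twConst M) (twInv q Q) := by
  have h1 := twMul_twInv q Q h.1 hq
  have h2 := twMul_twInv_right φ hφ hq Q h.1
  have h3 : twMul q (twInv q Q) (twMul q Q (twMul q (twConst M) (twInv q Q))) =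
      twMul q (twConst M) (twInv q Q) := by
    rw [← twMul_assoc φ hφ, h1, one_twMul]
  rw [← h3, ← twMul_assoc φ hφ Q, h.2, twMul_assoc φ hφ, h2, twMul_one hq]

end TwistedSeries

/-- On these rows the term N P_n of the functional equation disappears, so the recursion involves a
single row of P_n. The coordinate defining Li⋆ is of this kind. -/
lemma matN_last_row (R : Type*) [CommRing R] {r : ℕ} {s : Fin r → ℕ} {p : Coord s}
    (hp : (p.2 : ℕ) + 1 = blockDim s p.1) (p' : Coord s) : matN R s p p' = 0 := by
  rw [matN, if_neg]
  rintro ⟨h2, h3⟩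
  have h4 := p'.2.2
  have h5 := congrArg (blockDim s) h2
  omega

/-! ### Denominators of the logarithm coefficients. -/

section LogRow

variable (F : Type*) [Field F] [Fintype F] {r : ℕ} (s : Fin r → ℕ) (u : Fin r → F[X])

/-- The functional equation of the logarithm, on a row belonging to the last coordinate of a
block. -/
lemma logCoeff_last_row {p₀ : Coord s} (hp₀ : (p₀.2 : ℕ) + 1 = blockDim s p₀.1) (n : ℕ)
    (c : Coord s) :
    -algebraMap F[X] (RatFunc F) (bracket F (n + 1)) * logCoeff F s u (n + 1) p₀ c =
      ∑ c', logCoeff F s u (n + 1) p₀ c' * matN (RatFunc F) s c' c +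
        ∑ c', logCoeff F s u n p₀ c' *
          algebraMap F[X] (RatFunc F) (matE s u c' c) ^ Fintype.card F ^ n := by
  have hq : Fintype.card F ≠ 0 := Fintype.card_ne_zero
  have hexp : IsExp _ _ _ (expCoeff F s u) := (existsUnique_expCoeff F s u).choose_spec.1
  have h := hexp.twInv_mul (FiniteField.frobeniusAlgHom F (RatFunc F)).toRingHom
    (fun x => rfl) hq
  change twMul _ (logCoeff F s u) _ = twMul _ _ (logCoeff F s u) at h
  have h1 := congrFun (congrFun (congrFun h (n + 1)) p₀) c
  rw [twMul_twLinear_succ hq, twConst_mul] at h1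
  have hN := matN_last_row (RatFunc F) hp₀
  have hM : ((RatFunc.X : RatFunc F) • (1 : Matrix (Coord s) (Coord s) (RatFunc F)) +
      matN (RatFunc F) s).map (· ^ Fintype.card F ^ (n + 1)) =
      (RatFunc.X : RatFunc F) ^ Fintype.card F ^ (n + 1) • 1 + matN (RatFunc F) s := by
    ext a b
    have h0 : (0 : RatFunc F) ^ Fintype.card F ^ (n + 1) = 0 := zero_pow (pow_ne_zero _ hq)
    by_cases hp : a = b
    · subst hp
      simp [matN]
    · simp only [Matrix.map_apply, Matrix.add_apply, Matrix.smul_apply, Matrix.one_apply_ne hp,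
        smul_zero, zero_add, matN]
      split_ifs
      · exact one_pow _
      · exact h0
  have hE : ∀ c' c, matE s (fun i => algebraMap F[X] (RatFunc F) (u i)) c' c =
      algebraMap F[X] (RatFunc F) (matE s u c' c) := by
    intro c' c
    simp only [matE]
    split_ifs <;> simp
  rw [hM, mul_add, add_mul, Matrix.add_apply, Matrix.add_apply, Matrix.add_apply,
    Matrix.smul_mul, Matrix.mul_smul, mul_one, one_mul, Matrix.smul_apply, Matrix.smul_apply,
    Matrix.mul_apply, Matrix.mul_apply, Matrix.mul_apply] at h1
  simp only [hN, hE, Matrix.map_apply, zero_mul, Finset.sum_const_zero, add_zero,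
    smul_eq_mul] at h1
  have hb : algebraMap F[X] (RatFunc F) (bracket F (n + 1)) =
      RatFunc.X ^ Fintype.card F ^ (n + 1) - RatFunc.X := by simp [bracket]
  rw [hb]
  linear_combination -h1

lemma blockDim_le_weight (l : Fin r) : blockDim s l ≤ weight s :=
  Finset.sum_le_sum_of_subset (Finset.subset_univ _)

/-- On the last row of a block, `ord_v(P_n) ≥ -wt(𝔰) ⌊n / d⌋`. -/
lemma valuation_logCoeff_le (v : HeightOneSpectrum F[X]) {p₀ : Coord s}
    (hp₀ : (p₀.2 : ℕ) + 1 = blockDim s p₀.1) (n : ℕ) (c : Coord s) :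
    v.valuation (RatFunc F) (logCoeff F s u n p₀ c) ≤
      exp ((weight s * (n / placeDegree v) : ℕ) : ℤ) := by
  set w := v.valuation (RatFunc F)
  set d := placeDegree v
  induction n generalizing c with
  | zero =>
    rw [logCoeff, twInv_zero, Matrix.one_apply]
    split_ifs <;> simp
  | succ n ih =>
    set ε : ℤ := if d ∣ n + 1 then 1 else 0 with hε
    have hε0 : 0 ≤ ε := by rw [hε]; split_ifs <;> norm_num
    have hbr : exp (-ε) ≤ w (algebraMap F[X] (RatFunc F) (bracket F (n + 1))) := by
      rw [v.valuation_of_algebraMap]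
      exact exp_le_valuation_bracket v n
    -- Dividing by [n+1] costs at most ε in the order, with ε = 1 exactly when d ∣ n + 1.
    have key : ∀ x y : RatFunc F, ∀ k : ℤ,
        -algebraMap F[X] (RatFunc F) (bracket F (n + 1)) * x = y → w y ≤ exp k →
          w x ≤ exp (k + ε) := by
      intro x y k hxy hy
      rw [← hxy, map_mul, Valuation.map_neg] at hy
      have h1 : exp (-ε) * w x ≤ exp k := (mul_le_mul_left hbr _).trans hy
      calc w x = exp ε * (exp (-ε) * w x) := by
            rw [← mul_assoc, ← exp_add, add_neg_cancel, exp_zero, one_mul]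
        _ ≤ exp ε * exp k := mul_le_mul_right h1 _
        _ = exp (k + ε) := by rw [← exp_add, add_comm]
    have hrow := logCoeff_last_row F s u hp₀ n
    -- Walk through the columns of a block. In column 0 the matrix N contributes nothing and only
    -- P_n enters; in later columns E contributes nothing and N brings in the preceding column of
    -- P_{n+1}. Column k thus needs k + 1 divisions by [n+1], and k + 1 ≤ d_ℓ ≤ wt(𝔰).
    have hk : ∀ (k : ℕ) (l : Fin r) (hk : k < blockDim s l),
        w (logCoeff F s u (n + 1) p₀ ⟨l, k, hk⟩) ≤
          exp (((weight s * (n / d) : ℕ) : ℤ) + (k + 1) * ε) := by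
      intro k l
      induction k with
      | zero =>
        intro hk
        have h1 := hrow ⟨l, 0, hk⟩
        rw [Finset.sum_eq_zero (s := Finset.univ) (f := fun c' => logCoeff F s u (n + 1) p₀ c' *
          matN (RatFunc F) s c' ⟨l, 0, hk⟩) (fun c' _ => by
            rw [matN, if_neg (by simp), mul_zero]), zero_add] at h1
        have h2 := key _ _ ((weight s * (n / d) : ℕ) : ℤ) h1 (w.map_sum_le fun c' _ => by
          rw [map_mul, map_pow]
          refine (mul_le_mul' (ih c') (pow_le_one₀ zero_le (v.valuation_le_one _))).trans ?_
          rw [mul_one])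
        simpa using h2
      | succ k ihk =>
        intro hk
        have h1 := hrow ⟨l, k + 1, hk⟩
        rw [Finset.sum_eq_zero (s := Finset.univ) (f := fun c' => logCoeff F s u n p₀ c' *
            algebraMap F[X] (RatFunc F) (matE s u c' ⟨l, k + 1, hk⟩) ^ Fintype.card F ^ n)
          (fun c' _ => by
            rw [matE, if_neg (by simp), map_zero, zero_pow (pow_ne_zero _ Fintype.card_ne_zero),
              mul_zero]), add_zero,
          Finset.sum_eq_single (⟨l, k, by omega⟩ : Coord s)] at h1
        · rw [matN, if_pos (by simp), mul_one] at h1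
          have h2 := key _ _ _ h1 (ihk (by omega))
          refine h2.trans_eq ?_
          congr 1
          push_cast
          ring
        · rintro ⟨l', k'⟩ _ hne
          rw [matN, if_neg, mul_zero]
          rintro ⟨h2, h3⟩
          obtain rfl : l' = l := h2
          refine hne ?_
          congr 1
          ext
          simpa using h3
        · simp
    obtain ⟨l, k, hkl⟩ := c
    refine (hk k l hkl).trans ?_
    rw [exp_le_exp, Nat.succ_div]
    have h1 : (k : ℤ) + 1 ≤ weight s := by
      have := blockDim_le_weight s l
      omega
    have h2 := mul_le_mul_of_nonneg_right h1 hε0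
    have h3 : (((if d ∣ n + 1 then 1 else 0 : ℕ)) : ℤ) = ε := by
      rw [hε]; split_ifs <;> simp
    push_cast at h3 ⊢
    rw [h3]
    linarith

end LogRow

/-! ### Polynomials in intertwined operators, and the action of N and E on vectors. -/

section Semiconj

variable {F κ M N : Type*} [Field F] [Field κ] [Algebra F κ] [AddCommGroup M] [Module F M]
  [AddCommGroup N] [Module F N] [Module κ N] [IsScalarTower F κ N]

/-- The target operator is κ-linear so that a may later be factored over κ. Taking κ = F covers
plain reduction modulo v. -/
lemma map_aeval_apply_of_semiconj (f : M →ₗ[F] N) {T : Module.End F M} {S : Module.End κ N}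
    (h : ∀ x, f (T x) = S (f x)) (a : F[X]) (x : M) :
    f (aeval T a x) = aeval S (a.map (algebraMap F κ)) (f x) := by
  induction a using Polynomial.induction_on' generalizing x with
  | add a b ha hb => simp [ha, hb]
  | monomial n c =>
    have hpow : ∀ x, f ((T ^ n) x) = (S ^ n) (f x) := by
      induction n with
      | zero => simp
      | succ n ih => intro x; rw [pow_succ, pow_succ, Module.End.mul_apply, ih, h]; rfl
    rw [aeval_monomial, Polynomial.map_monomial, aeval_monomial, Module.End.mul_apply,
      Module.End.mul_apply, Module.algebraMap_end_apply, Module.algebraMap_end_apply, map_smul,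
      hpow, algebraMap_smul]

end Semiconj

section MulVec

variable {R : Type*} [CommRing R] {r : ℕ} {s : Fin r → ℕ}

lemma matN_mulVec_of_lt (x : Coord s → R) {l : Fin r} {k : ℕ} (hk : k + 1 < blockDim s l) :
    (matN R s).mulVec x ⟨l, k, by omega⟩ = x ⟨l, k + 1, hk⟩ := by
  rw [Matrix.mulVec, dotProduct, Finset.sum_eq_single (⟨l, k + 1, hk⟩ : Coord s)]
  · rw [matN, if_pos ⟨rfl, rfl⟩, one_mul]
  · rintro ⟨l', k'⟩ _ hne
    rw [matN, if_neg, zero_mul]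
    rintro ⟨h2, h3⟩
    obtain rfl : l = l' := h2
    refine hne ?_
    congr 1
    ext
    exact h3.symm
  · simp

lemma matN_mulVec_last (x : Coord s → R) {p : Coord s} (hp : (p.2 : ℕ) + 1 = blockDim s p.1) :
    (matN R s).mulVec x p = 0 := by
  refine Finset.sum_eq_zero fun p' _ => ?_
  change matN R s p p' * x p' = 0
  rw [matN_last_row R hp, zero_mul]

lemma matE_mulVec_of_ne (u : Fin r → R) (x : Coord s → R) {p : Coord s}
    (hp : (p.2 : ℕ) + 1 ≠ blockDim s p.1) : (matE s u).mulVec x p = 0 := by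
  refine Finset.sum_eq_zero fun p' _ => ?_
  change matE s u p p' * x p' = 0
  rw [matE, if_neg (fun h => hp h.2.1), zero_mul]

/-- E is block upper triangular: once x vanishes on later blocks, only the corner of the diagonal
block remains, and it is an empty product. -/
lemma matE_mulVec_last (u : Fin r → R) (x : Coord s → R) {l : Fin r} {k : ℕ}
    (hk : k + 1 = blockDim s l) (hx : ∀ m k', l < m → x ⟨m, k'⟩ = 0) :
    (matE s u).mulVec x ⟨l, k, by omega⟩ = x ⟨l, 0, by omega⟩ := by
  rw [Matrix.mulVec, dotProduct, Finset.sum_eq_single (⟨l, 0, by omega⟩ : Coord s)]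
  · simp [matE, hk]
  · rintro ⟨m, k'⟩ _ hne
    by_cases hlm : l < m
    · rw [hx m k' hlm, mul_zero]
    · rw [matE, if_neg, zero_mul]
      rintro ⟨h1, -, h3⟩
      obtain rfl : l = m := le_antisymm h1 (not_lt.1 hlm)
      refine hne ?_
      congr 1
      ext
      exact h3
  · simp

end MulVec

/-! ### The action of F[t] on the points of G over the residue field. -/

section Residue

variable {F κ : Type*} [Field F] [Fintype F] [Field κ] [Algebra F κ]

variable (F) in
lemma frobeniusAlgHom_pow_apply {R : Type*} [CommRing R] [Algebra F R] (i : ℕ) (x : R) :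
    (FiniteField.frobeniusAlgHom F R ^ i) x = x ^ Fintype.card F ^ i := by
  rw [AlgHom.coe_pow, FiniteField.coe_frobeniusAlgHom, pow_iterate]

variable (F) in
lemma matE_apply_pow_card {R : Type*} [CommRing R] [Algebra F R] {r : ℕ} (s : Fin r → ℕ)
    (u : Fin r → R) (i : ℕ) (p p' : Coord s) :
    matE s u p p' ^ Fintype.card F ^ i = matE s (fun e => u e ^ Fintype.card F ^ i) p p' := by
  simp only [← frobeniusAlgHom_pow_apply, matE]
  split_ifs
  · simp only [map_mul, map_pow, map_neg, map_one, map_prod]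
  · exact map_zero _

variable (F) in
lemma matN_apply_pow_card {R : Type*} [CommRing R] [Algebra F R] {r : ℕ} (s : Fin r → ℕ)
    (i : ℕ) (p p' : Coord s) :
    matN R s p p' ^ Fintype.card F ^ i = matN R s p p' := by
  simp only [← frobeniusAlgHom_pow_apply, matN]
  split_ifs <;> simp

variable (F) in
/-- The operator `ρ_t = θ + N + E τ` on the points of `G_{𝔰,𝐮}` over a field containing `𝔽_q`. -/
noncomputable def fieldRhoT (θ : κ) {r : ℕ} (s : Fin r → ℕ) (u : Fin r → κ) :
    Module.End F (Coord s → κ) where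
  toFun x := θ • x + (matN κ s).mulVec x + (matE s u).mulVec fun p => x p ^ Fintype.card F
  map_add' x y := by
    have h : (fun p => (x + y) p ^ Fintype.card F) =
        (fun p => x p ^ Fintype.card F) + fun p => y p ^ Fintype.card F :=
      funext fun p => map_add (FiniteField.frobeniusAlgHom F κ) (x p) (y p)
    rw [h, smul_add, Matrix.mulVec_add, Matrix.mulVec_add]
    abel
  map_smul' c x := by
    have h : (fun p => (c • x) p ^ Fintype.card F) = c • fun p => x p ^ Fintype.card F :=
      funext fun p => map_smul (FiniteField.frobeniusAlgHom F κ) c (x p)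
    rw [h, Matrix.mulVec_smul, Matrix.mulVec_smul, RingHom.id_apply, smul_add, smul_add,
      smul_comm c θ x]

variable (F) in
/-- The linearization of `ρ_t` on sequences of Frobenius twists. -/
noncomputable def twistRhoT (θ : κ) {r : ℕ} (s : Fin r → ℕ) (u : Fin r → κ) :
    Module.End κ (ℕ → Coord s → κ) where
  toFun x i := θ ^ Fintype.card F ^ i • x i + (matN κ s).mulVec (x i) +
    (matE s fun e => u e ^ Fintype.card F ^ i).mulVec (x (i + 1))
  map_add' x y := by
    funext i
    simp only [Pi.add_apply, smul_add, Matrix.mulVec_add]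
    abel
  map_smul' c x := by
    funext i
    simp only [Pi.smul_apply, Matrix.mulVec_smul, RingHom.id_apply, smul_add]
    rw [smul_comm]

variable (F κ) in
/-- The sequence of Frobenius twists of a vector. -/
noncomputable def twistSeq (ι : Type*) : (ι → κ) →ₗ[F] (ℕ → ι → κ) where
  toFun x i p := x p ^ Fintype.card F ^ i
  map_add' x y := by
    funext i p
    simp only [← frobeniusAlgHom_pow_apply, Pi.add_apply, map_add]
  map_smul' c x := by
    funext i p
    simp only [← frobeniusAlgHom_pow_apply, Pi.smul_apply, map_smul, RingHom.id_apply]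

/-- Raise ρ_t(x) to the power q^i; N is fixed by Frobenius. The semilinear term E τ turns into a
κ-linear shift i ↦ i + 1, which is the purpose of passing to sequences. -/
lemma twistSeq_fieldRhoT (θ : κ) {r : ℕ} (s : Fin r → ℕ) (u : Fin r → κ) (x : Coord s → κ) :
    twistSeq F κ _ (fieldRhoT F θ s u x) = twistRhoT F θ s u (twistSeq F κ _ x) := by
  funext i p
  change (θ * x p + ∑ p', matN κ s p p' * x p' +
    ∑ p', matE s u p p' * x p' ^ Fintype.card F) ^ Fintype.card F ^ i =
    θ ^ Fintype.card F ^ i * x p ^ Fintype.card F ^ i +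
      ∑ p', matN κ s p p' * x p' ^ Fintype.card F ^ i +
      ∑ p', matE s (fun e => u e ^ Fintype.card F ^ i) p p' * x p' ^ Fintype.card F ^ (i + 1)
  rw [← frobeniusAlgHom_pow_apply]
  simp only [map_add, map_mul, map_sum, frobeniusAlgHom_pow_apply, matN_apply_pow_card,
    matE_apply_pow_card]
  simp only [← pow_mul, pow_succ']

variable [Finite κ]

lemma pow_card_pow_add (x : κ) (i : ℕ) :
    x ^ Fintype.card F ^ (i + Module.finrank F κ) = x ^ Fintype.card F ^ i := by
  have := Fintype.ofFinite κ
  rw [pow_add, pow_mul', ← Module.card_eq_pow_finrank, FiniteField.pow_card]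

/-- On periodic sequences, `θ^{q^j}` is no eigenvalue of the linearization of `ρ_t`. -/
lemma eq_zero_of_twistRhoT_eq_smul {θ : κ} {r : ℕ} {s : Fin r → ℕ} {u : Fin r → κ} {j : ℕ}
    {y : ℕ → Coord s → κ} (hper : ∀ i, y (i + Module.finrank F κ) = y i)
    (hy : twistRhoT F θ s u y = θ ^ Fintype.card F ^ j • y) : y = 0 := by
  have hD : 0 < Module.finrank F κ := Module.finrank_pos
  have heq : ∀ i p, θ ^ Fintype.card F ^ i * y i p + (matN κ s).mulVec (y i) p +
      (matE s fun e => u e ^ Fintype.card F ^ i).mulVec (y (i + 1)) p =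
      θ ^ Fintype.card F ^ j * y i p := fun i p => congrFun (congrFun hy i) p
  -- Blocks are treated from the last to the first, so that E couples block l only to itself.
  have hblock : ∀ l : Fin r, (∀ m, l < m → ∀ i k, y i ⟨m, k⟩ = 0) → ∀ i k, y i ⟨l, k⟩ = 0 := by
    intro l hl
    by_cases hpos : 0 < blockDim s l
    swap
    · exact fun i k => absurd k.2 (by omega)
    have hstep : ∀ i k (hk : k + 1 < blockDim s l), θ ^ Fintype.card F ^ i * y i ⟨l, k, by omega⟩ +
        y i ⟨l, k + 1, hk⟩ = θ ^ Fintype.card F ^ j * y i ⟨l, k, by omega⟩ := by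
      intro i k hk
      have := heq i ⟨l, k, by omega⟩
      rwa [matN_mulVec_of_lt _ hk, matE_mulVec_of_ne _ _ (by simpa using hk.ne), add_zero] at this
    have hlast : ∀ i, θ ^ Fintype.card F ^ i * y i ⟨l, blockDim s l - 1, by omega⟩ +
        y (i + 1) ⟨l, 0, hpos⟩ =
          θ ^ Fintype.card F ^ j * y i ⟨l, blockDim s l - 1, by omega⟩ := by
      intro i
      have hk : blockDim s l - 1 + 1 = blockDim s l := by omega
      have := heq i ⟨l, blockDim s l - 1, by omega⟩
      rwa [matN_mulVec_last _ hk, matE_mulVec_last _ _ hk fun m k' hm => hl m hm _ _,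
        add_zero] at this
    have hrow : ∀ i, y i ⟨l, 0, hpos⟩ = 0 → ∀ k hk, y i ⟨l, k, hk⟩ = 0 := by
      intro i h0 k
      induction k with
      | zero => exact fun _ => h0
      | succ k ih =>
        intro hk
        have := hstep i k hk
        rwa [ih, mul_zero, mul_zero, zero_add] at this
    -- At i = j the two scalars in the last-coordinate equation cancel, leaving the first coordinate
    -- of y_{j+1} equal to 0. Then `hrow` kills the whole block of y_{j+1}, its last-coordinate
    -- equation kills the first coordinate of y_{j+2}, and so on.
    have hfirst : ∀ n, y (j + 1 + n) ⟨l, 0, hpos⟩ = 0 := by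
      intro n
      induction n with
      | zero => simpa using hlast j
      | succ n ih =>
        have := hlast (j + 1 + n)
        rwa [hrow _ ih, mul_zero, mul_zero, zero_add] at this
    have hmul : ∀ n i, y (i + n * Module.finrank F κ) = y i := by
      intro n i
      induction n with
      | zero => simp
      | succ n ih => rw [add_mul, one_mul, ← add_assoc, hper, ih]
    intro i k
    -- Shifting by j + 1 periods, each of length at least 1, brings any index beyond j.
    rw [← hmul (j + 1) i]
    obtain ⟨n, hn⟩ : ∃ n, i + (j + 1) * Module.finrank F κ = j + 1 + n :=
      ⟨i + (j + 1) * Module.finrank F κ - (j + 1), by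
        have := Nat.le_mul_of_pos_right (j + 1) hD
        omega⟩
    rw [hn]
    exact hrow _ (hfirst n) k k.2
  funext i ⟨l, k⟩
  have hall : ∀ n, ∀ l : Fin r, r ≤ (l : ℕ) + n → ∀ i k, y i ⟨l, k⟩ = 0 := by
    intro n
    induction n with
    | zero => exact fun l hl => absurd l.2 (by omega)
    | succ n ih => exact fun l hl => hblock l fun m hm => ih m (by have := Fin.lt_def.1 hm; omega)
  exact hall r l (by omega) i k

lemma eq_zero_of_aeval_twistRhoT_eq_zero {θ : κ} {r : ℕ} {s : Fin r → ℕ} {u : Fin r → κ}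
    {a : κ[X]} (ha : a.Splits) (ha0 : a ≠ 0)
    (hroot : ∀ c ∈ a.roots, ∃ j : ℕ, c = θ ^ Fintype.card F ^ j)
    {y : ℕ → Coord s → κ} (hper : ∀ i, y (i + Module.finrank F κ) = y i)
    (hy : aeval (twistRhoT F θ s u) a y = 0) : y = 0 := by
  -- Linear factors are peeled off one at a time, so the eigenvector argument is applied to the
  -- image of y under the remaining factors. That image is still periodic because the twists of θ
  -- and u have the same period.
  have hpres : ∀ b : κ[X], ∀ i, aeval (twistRhoT F θ s u) b y (i + Module.finrank F κ) =
      aeval (twistRhoT F θ s u) b y i := by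
    intro b
    induction b using Polynomial.induction_on with
    | C c => simpa using fun i => congrArg (c • ·) (hper i)
    | add b b' hb hb' => simp [hb, hb']
    | monomial n c ih =>
      intro i
      rw [pow_succ', ← mul_assoc, mul_comm _ X, mul_assoc, map_mul, aeval_X, Module.End.mul_apply]
      generalize aeval (twistRhoT F θ s u) (C c * X ^ n) y = z at ih
      change _ • z _ + _ + _ = _ • z _ + _ + _
      rw [ih, pow_card_pow_add, add_right_comm i, ih]
      simp only [pow_card_pow_add]
  have key : ∀ S : Multiset κ, (∀ c ∈ S, ∃ j : ℕ, c = θ ^ Fintype.card F ^ j) →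
      aeval (twistRhoT F θ s u) (S.map fun c => X - C c).prod y = 0 → y = 0 := by
    intro S
    induction S using Multiset.induction_on with
    | empty => simp
    | cons c S ih =>
      intro hS h
      refine ih (fun c hc => hS c (Multiset.mem_cons_of_mem hc)) ?_
      obtain ⟨j, hj⟩ := hS c (Multiset.mem_cons_self c S)
      rw [Multiset.map_cons, Multiset.prod_cons, map_mul, Module.End.mul_apply] at h
      refine eq_zero_of_twistRhoT_eq_smul (θ := θ) (u := u) (j := j) (hpres _) ?_
      rw [← hj, ← sub_eq_zero]
      simpa using h
  refine key a.roots hroot ?_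
  rw [ha.eq_prod_roots, map_mul, Module.End.mul_apply, aeval_C, Module.algebraMap_end_apply,
    smul_eq_zero] at hy
  exact hy.resolve_left (leadingCoeff_ne_zero.2 ha0)

/-- `v(t)` acts injectively on `G_{𝔰,𝐮}(𝔽_v)`. -/
lemma aeval_fieldRhoT_minpoly_injective (θ : κ) {r : ℕ} (s : Fin r → ℕ) (u : Fin r → κ) :
    Function.Injective (aeval (fieldRhoT F θ s u) (minpoly F θ)) := by
  have hint : IsIntegral F θ := Algebra.IsIntegral.isIntegral θ
  rw [← LinearMap.ker_eq_bot, LinearMap.ker_eq_bot']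
  intro x hx
  have h1 := map_aeval_apply_of_semiconj (twistSeq F κ _) (twistSeq_fieldRhoT θ s u)
    (minpoly F θ) x
  rw [hx, map_zero] at h1
  have h2 := eq_zero_of_aeval_twistRhoT_eq_zero (F := F) (Normal.splits inferInstance θ)
    (Polynomial.map_ne_zero (minpoly.ne_zero hint)) (fun c hc => ?_) (fun i => ?_) h1.symm
  · funext p
    have := congrFun (congrFun h2 0) p
    simpa [twistSeq] using this
  · have hc' : aeval c (minpoly F θ) = 0 := by
      have := (mem_roots'.1 hc).2
      rwa [IsRoot, eval_map_algebraMap] at this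
    -- The roots are Galois conjugates of θ, and the Galois group of κ over F consists of powers of
    -- Frobenius.
    obtain ⟨σ, hσ⟩ := ((isConjRoot_iff_aeval_eq_zero hint).2 hc').symm.exists_algEquiv
    obtain ⟨n, rfl⟩ := (FiniteField.bijective_frobeniusAlgEquivOfAlgebraic_pow F κ).2 σ
    refine ⟨n, hσ.symm.trans ?_⟩
    change (FiniteField.frobeniusAlgEquivOfAlgebraic F κ ^ (n : ℕ)) θ = _
    rw [AlgEquiv.coe_pow, FiniteField.coe_frobeniusAlgEquivOfAlgebraic_iterate]
  · funext p
    exact pow_card_pow_add _ _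

/-- Some `a ∈ 𝔽_q[t]` with `a(θ) ≠ 0` kills all of `G_{𝔰,𝐮}(𝔽_v)`. -/
lemma exists_aeval_fieldRhoT_eq_zero (θ : κ) {r : ℕ} (s : Fin r → ℕ) (u : Fin r → κ) :
    ∃ a : F[X], aeval θ a ≠ 0 ∧ aeval (fieldRhoT F θ s u) a = 0 := by
  set W := aeval (fieldRhoT F θ s u) (minpoly F θ) with hW
  have hbij : Function.Bijective W :=
    Finite.injective_iff_bijective.1 (aeval_fieldRhoT_minpoly_injective θ s u)
  obtain ⟨U, hU⟩ := (Module.End.isUnit_iff W).2 hbij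
  have hfin : Finite (Module.End F (Coord s → κ))ˣ := by
    have : Finite (Module.End F (Coord s → κ)) := DFunLike.finite _
    infer_instance
  obtain ⟨n, hn, hn1⟩ := (isOfFinOrder_of_finite U).exists_pow_eq_one
  -- The minimal polynomial acts with finite order n; at θ itself this polynomial takes the value
  -- -1.
  refine ⟨minpoly F θ ^ n - 1, ?_, ?_⟩
  · rw [map_sub, map_pow, minpoly.aeval, zero_pow hn.ne']
    simp
  · rw [map_sub, map_pow, ← hW, ← hU, map_one, ← Units.val_pow_eq_pow_val, hn1, Units.val_one,
      sub_self]

end Residue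

/-! ### Admissible polynomials prime to v. -/

section Admissible

variable {F : Type*} [Field F] [Fintype F]

/-- An admissible `a` may be chosen prime to `v`. -/
lemma exists_isAdmissible_notMem (v : HeightOneSpectrum F[X]) {r : ℕ} (s : Fin r → ℕ)
    (u : Fin r → F[X]) : ∃ a, IsAdmissible v s u a ∧ a ∉ v.asIdeal := by
  have := finite_residue v
  have := v.isMaximal
  let _ := Ideal.Quotient.field v.asIdeal
  let π := Ideal.Quotient.mkₐ F v.asIdeal
  obtain ⟨a, ha, ha'⟩ := exists_aeval_fieldRhoT_eq_zero (F := F) (π X) s (π ∘ u)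
  have hmem : a ∉ v.asIdeal := by
    rwa [aeval_algHom_apply, aeval_X_left_apply, Ne, Ideal.Quotient.mkₐ_eq_mk,
      Ideal.Quotient.eq_zero_iff_mem] at ha
  refine ⟨a, ⟨fun h => hmem (h ▸ zero_mem _), fun p => ?_⟩, hmem⟩
  have hE : ∀ p p', π (matE s u p p') = matE s (π ∘ u) p p' := by
    intro p p'
    simp only [matE]
    split_ifs <;> simp [map_prod]
  have hN : ∀ p p', π (matN F[X] s p p') = matN _ s p p' := by
    intro p p'
    simp only [matN]
    split_ifs <;> simp
  have h := map_aeval_apply_of_semiconj (κ := F) (π.toLinearMap.compLeft (Coord s))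
    (T := rhoT s u) (S := fieldRhoT F (π X) s (π ∘ u)) (fun x => by
      funext p
      change π (X * x p + ∑ p', matN F[X] s p p' * x p' +
        ∑ p', matE s u p p' * x p' ^ Fintype.card F) =
        π X * π (x p) + ∑ p', matN _ s p p' * π (x p') +
          ∑ p', matE s (π ∘ u) p p' * π (x p') ^ Fintype.card F
      simp only [map_add, map_mul, map_sum, map_pow, hE, hN]) a (specialPoint s u)
  rw [Algebra.algebraMap_self, Polynomial.map_id, ha'] at h
  have h2 : π (rho s u a (specialPoint s u) p) = 0 := congrFun h p
  exact (HeightOneSpectrum.valuedAdicCompletion_eq_valuation v _).trans_lt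
    ((HeightOneSpectrum.valuation_lt_one_iff_mem v _).2 (Ideal.Quotient.eq_zero_iff_mem.1 h2))

end Admissible

/-! ### Convergence and ultrametric bounds in valued rings. -/

section Valued

variable {R : Type*} [Ring R] [Valued R ℤᵐ⁰]

lemma nonarchimedeanAddGroup_of_valued : NonarchimedeanAddGroup R where
  is_nonarchimedean U hU := by
    obtain ⟨γ, hγ⟩ := Valued.mem_nhds_zero.1 hU
    exact ⟨⟨Valuation.ltAddSubgroup Valued.v.restrict γ, Valued.isOpen_ball R γ.1⟩, hγ⟩

lemma tendsto_zero_of_valued {α : Type*} {l : Filter α} {f : α → R}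
    (h : ∀ k : ℤ, ∀ᶠ i in l, Valued.v (f i) < exp k) : Tendsto f l (𝓝 0) := by
  intro U hU
  obtain ⟨γ, hγ⟩ := Valued.mem_nhds_zero.1 hU
  have h0 : MonoidWithZeroHom.ValueGroup₀.embedding γ.1 ≠ 0 := (_root_.map_ne_zero _).2 γ.ne_zero
  refine mem_map.2 ((h (log (MonoidWithZeroHom.ValueGroup₀.embedding γ.1))).mono fun i hi => hγ ?_)
  change Valued.v.restrict (f i) < γ.1
  rw [Valuation.restrict_lt_iff_lt_embedding]
  rwa [exp_log h0] at hi

/-- The valuation is locally constant away from 0, so some finite partial sum has the valuation of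
the limit. A divergent sum is 0 by convention and satisfies the bound as well. -/
lemma valued_tsum_le {α : Type*} {f : α → R} {b : ℤᵐ⁰} (h : ∀ i, Valued.v (f i) ≤ b) :
    Valued.v (∑' i, f i) ≤ b := by
  by_cases hf : Summable f
  · by_contra! hlt
    have h1 := Valued.locally_const (x := ∑' i, f i) (ne_of_gt (zero_le.trans_lt hlt))
    obtain ⟨S, hS⟩ := (hf.hasSum.eventually h1).exists
    have h2 : Valued.v (∑ i ∈ S, f i) ≤ b := Valued.v.map_sum_le fun i _ => h i
    exact absurd (hS ▸ h2) (not_le.2 hlt)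
  · rw [tsum_eq_zero_of_not_summable hf, map_zero]
    exact zero_le

end Valued

/-! ### Convergence, size and F[t]-linearity of the v-adic logarithm. -/

section LogSeries

variable {F : Type*} [Field F] [Fintype F] (v : HeightOneSpectrum F[X]) {r : ℕ} (s : Fin r → ℕ)
  (u : Fin r → F[X])

lemma valued_algebraMap (a : F[X]) :
    Valued.v (algebraMap F[X] (v.adicCompletion (RatFunc F)) a) = v.intValuation a :=
  (HeightOneSpectrum.valuedAdicCompletion_eq_valuation v a).trans (v.valuation_of_algebraMap a)

lemma valued_algebraMap_lt_one_iff (a : F[X]) :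
    Valued.v (algebraMap F[X] (v.adicCompletion (RatFunc F)) a) < 1 ↔ a ∈ v.asIdeal := by
  rw [valued_algebraMap, v.intValuation_lt_one_iff_mem]

lemma valued_algebraMap_le_one (a : F[X]) :
    Valued.v (algebraMap F[X] (v.adicCompletion (RatFunc F)) a) ≤ 1 := by
  rw [valued_algebraMap]
  exact v.intValuation_le_one a

/-- The `i`-th term of the coordinate `p₀` of `log_G(x)`. -/
noncomputable def logTerm (p₀ : Coord s) (x : Coord s → F[X]) (i : ℕ) : RatFunc F :=
  ∑ p, logCoeff F s u i p₀ p * algebraMap F[X] (RatFunc F) (x p) ^ Fintype.card F ^ i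

/-- The difference between the partial sums of `log_G(ρ_t(x))` and of `∂ρ_t log_G(x)`. -/
noncomputable def logDefect (p₀ : Coord s) (x : Coord s → F[X]) : ℕ → RatFunc F
  | 0 => 0
  | i + 1 => ∑ p, (∑ p', logCoeff F s u i p₀ p' *
      algebraMap F[X] (RatFunc F) (matE s u p' p) ^ Fintype.card F ^ i) *
      algebraMap F[X] (RatFunc F) (x p) ^ Fintype.card F ^ (i + 1)

/-- The value of the coordinate `p₀` of `log_G(x)` in `k_v`. -/
noncomputable def logSum (p₀ : Coord s) (x : Coord s → F[X]) : v.adicCompletion (RatFunc F) :=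
  ∑' i, algebraMap (RatFunc F) (v.adicCompletion (RatFunc F)) (logTerm s u p₀ x i)

variable {v s u}

/-- Take n = ⌊i/d⌋ in the minimum, and use q_v^n = q^(dn) ≤ q^i. -/
lemma boundB_le (w i : ℕ) :
    boundB v w ≤ (Fintype.card F : ℤ) ^ i - (w * (i / placeDegree v) : ℕ) := by
  have h := (isLeast_boundB v w).2 ⟨i / placeDegree v, rfl⟩
  have h1 : qv v ^ (i / placeDegree v) ≤ Fintype.card F ^ i := by
    rw [qv_eq, ← pow_mul]
    exact Nat.pow_le_pow_right Fintype.card_pos (Nat.mul_div_le i _)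
  zify at h1
  push_cast at h ⊢
  linarith

/-- Using the bound for weight w + 1 leaves a spare ⌊i/d⌋, so the orders of the terms tend to
infinity with no further growth estimate. -/
lemma boundB_add_le (w i : ℕ) : boundB v (w + 1) + (i / placeDegree v : ℕ) ≤
    (Fintype.card F : ℤ) ^ i - (w * (i / placeDegree v) : ℕ) := by
  have h := boundB_le (v := v) (w + 1) i
  push_cast at h ⊢
  linarith

lemma tendsto_zero_of_le_exp {f : ℕ → RatFunc F} (w : ℕ)
    (h : ∀ i, v.valuation (RatFunc F) (f i) ≤
      exp (((w * (i / placeDegree v) : ℕ) : ℤ) - (Fintype.card F : ℤ) ^ i)) :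
    Tendsto (fun i => algebraMap (RatFunc F) (v.adicCompletion (RatFunc F)) (f i)) atTop
      (𝓝 0) := by
  refine tendsto_zero_of_valued fun k => ?_
  filter_upwards [eventually_ge_atTop
    ((1 - k - boundB v (w + 1)).toNat * placeDegree v)] with i hi
  refine (HeightOneSpectrum.valuedAdicCompletion_eq_valuation' v _).trans_lt
    ((h i).trans_lt ?_)
  rw [exp_lt_exp]
  have h1 := (Nat.le_div_iff_mul_le (placeDegree_pos v)).2 hi
  have h2 := Int.self_le_toNat (1 - k - boundB v (w + 1))
  have h3 := boundB_add_le (v := v) w i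
  omega

lemma valuation_pow_le {a : F[X]} (ha : a ∈ v.asIdeal) (n : ℕ) :
    v.valuation (RatFunc F) (algebraMap F[X] (RatFunc F) a) ^ n ≤ exp (-(n : ℤ)) := by
  have h : v.valuation (RatFunc F) (algebraMap F[X] (RatFunc F) a) ≤ exp (-1 : ℤ) := by
    rw [v.valuation_of_algebraMap]
    simpa using (v.intValuation_le_pow_iff_mem a 1).2 (by simpa using ha)
  refine (pow_le_pow_left' h n).trans_eq ?_
  rw [← exp_nsmul]
  simp

lemma valuation_logTerm_le {p₀ : Coord s} (hp₀ : (p₀.2 : ℕ) + 1 = blockDim s p₀.1)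
    {x : Coord s → F[X]} (hx : ∀ p, x p ∈ v.asIdeal) (i : ℕ) :
    v.valuation (RatFunc F) (logTerm s u p₀ x i) ≤
      exp (((weight s * (i / placeDegree v) : ℕ) : ℤ) - (Fintype.card F : ℤ) ^ i) := by
  refine (v.valuation (RatFunc F)).map_sum_le fun p _ => ?_
  rw [map_mul, map_pow, sub_eq_add_neg, exp_add]
  refine mul_le_mul' (valuation_logCoeff_le F s u v hp₀ i p)
    ((valuation_pow_le (hx p) _).trans_eq ?_)
  push_cast
  rfl

lemma valuation_logDefect_le {p₀ : Coord s} (hp₀ : (p₀.2 : ℕ) + 1 = blockDim s p₀.1)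
    {x : Coord s → F[X]} (hx : ∀ p, x p ∈ v.asIdeal) (i : ℕ) :
    v.valuation (RatFunc F) (logDefect s u p₀ x i) ≤
      exp (((weight s * (i / placeDegree v) : ℕ) : ℤ) - (Fintype.card F : ℤ) ^ i) := by
  cases i with
  | zero => rw [logDefect, map_zero]; exact zero_le
  | succ i =>
    refine (v.valuation (RatFunc F)).map_sum_le fun p _ => ?_
    rw [map_mul, map_pow, sub_eq_add_neg, exp_add]
    refine mul_le_mul' ((v.valuation (RatFunc F)).map_sum_le fun p' _ => ?_)
      ((valuation_pow_le (hx p) _).trans_eq (by push_cast; rfl))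
    rw [map_mul, map_pow]
    refine (mul_le_mul' (valuation_logCoeff_le F s u v hp₀ i p')
      (pow_le_one₀ zero_le (v.valuation_le_one _))).trans ?_
    rw [mul_one, exp_le_exp]
    exact_mod_cast Nat.mul_le_mul_left _ (Nat.div_le_div_right (Nat.le_succ i))

lemma summable_logTerm {p₀ : Coord s} (hp₀ : (p₀.2 : ℕ) + 1 = blockDim s p₀.1)
    {x : Coord s → F[X]} (hx : ∀ p, x p ∈ v.asIdeal) :
    Summable fun i => algebraMap (RatFunc F) (v.adicCompletion (RatFunc F))
      (logTerm s u p₀ x i) := by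
  have := nonarchimedeanAddGroup_of_valued (R := v.adicCompletion (RatFunc F))
  refine NonarchimedeanAddGroup.summable_of_tendsto_cofinite_zero ?_
  rw [Nat.cofinite_eq_atTop]
  exact tendsto_zero_of_le_exp _ (valuation_logTerm_le hp₀ hx)

lemma valued_logSum_le {p₀ : Coord s} (hp₀ : (p₀.2 : ℕ) + 1 = blockDim s p₀.1)
    {x : Coord s → F[X]} (hx : ∀ p, x p ∈ v.asIdeal) :
    Valued.v (logSum v s u p₀ x) ≤ exp (-boundB v (weight s)) := by
  refine valued_tsum_le fun i => (HeightOneSpectrum.valuedAdicCompletion_eq_valuation' v _).trans_le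
    ((valuation_logTerm_le hp₀ hx i).trans ?_)
  rw [exp_le_exp]
  have := boundB_le (v := v) (weight s) i
  linarith

lemma rhoT_apply_pow_card (x : Coord s → F[X]) (p : Coord s) (i : ℕ) :
    rhoT s u x p ^ Fintype.card F ^ i =
      X ^ Fintype.card F ^ i * x p ^ Fintype.card F ^ i +
        ∑ p', matN F[X] s p p' * x p' ^ Fintype.card F ^ i +
        ∑ p', matE s u p p' ^ Fintype.card F ^ i * x p' ^ Fintype.card F ^ (i + 1) := by
  change (X * x p + ∑ p', matN F[X] s p p' * x p' +
      ∑ p', matE s u p p' * x p' ^ Fintype.card F) ^ Fintype.card F ^ i = _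
  rw [← frobeniusAlgHom_pow_apply]
  simp only [map_add, map_mul, map_sum]
  simp only [frobeniusAlgHom_pow_apply, matN_apply_pow_card, ← pow_mul, pow_succ']

/-- In P_i (ρ_t x)^{(i)} the E part carries the twist i + 1 and is the next defect; by the
functional equation the remaining part is θ times the i-th term minus the current defect. The
defects therefore telescope. -/
lemma logTerm_rhoT {p₀ : Coord s} (hp₀ : (p₀.2 : ℕ) + 1 = blockDim s p₀.1)
    (x : Coord s → F[X]) (i : ℕ) :
    logTerm s u p₀ (rhoT s u x) i =
      algebraMap F[X] (RatFunc F) X * logTerm s u p₀ x i -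
        logDefect s u p₀ x i + logDefect s u p₀ x (i + 1) := by
  set ι := algebraMap F[X] (RatFunc F) with hι
  have hrho : ∀ p, ι (rhoT s u x p) ^ Fintype.card F ^ i =
      ι X ^ Fintype.card F ^ i * ι (x p) ^ Fintype.card F ^ i +
        ∑ p', matN (RatFunc F) s p p' * ι (x p') ^ Fintype.card F ^ i +
        ∑ p', ι (matE s u p p') ^ Fintype.card F ^ i *
          ι (x p') ^ Fintype.card F ^ (i + 1) := by
    intro p
    have hN : ∀ p', ι (matN F[X] s p p') = matN (RatFunc F) s p p' := by
      intro p'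
      simp only [matN]
      split_ifs <;> simp
    rw [← map_pow, rhoT_apply_pow_card]
    simp only [map_add, map_mul, map_sum, map_pow, hN]
  have hdefect : ∑ p, logCoeff F s u i p₀ p * ∑ p', ι (matE s u p p') ^ Fintype.card F ^ i *
      ι (x p') ^ Fintype.card F ^ (i + 1) = logDefect s u p₀ x (i + 1) := by
    rw [logDefect]
    simp only [Finset.mul_sum, Finset.sum_mul]
    rw [Finset.sum_comm]
    simp only [mul_assoc, ι]
  have hmain : ∑ p, logCoeff F s u i p₀ p * (ι X ^ Fintype.card F ^ i *
      ι (x p) ^ Fintype.card F ^ i) + ∑ p, logCoeff F s u i p₀ p *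
        ∑ p', matN (RatFunc F) s p p' * ι (x p') ^ Fintype.card F ^ i =
      ι X * logTerm s u p₀ x i - logDefect s u p₀ x i := by
    have hswap : ∑ p, logCoeff F s u i p₀ p *
        ∑ p', matN (RatFunc F) s p p' * ι (x p') ^ Fintype.card F ^ i =
        ∑ p, (∑ p', logCoeff F s u i p₀ p' * matN (RatFunc F) s p' p) *
          ι (x p) ^ Fintype.card F ^ i := by
      simp only [Finset.mul_sum, Finset.sum_mul]
      rw [Finset.sum_comm]
      simp only [mul_assoc]
    rw [hswap]
    -- For i = 0 no functional equation is needed: P_0 = 1, the last row of N is zero, and the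
    -- zeroth defect is 0 by definition.
    cases i with
    | zero =>
      have h0 : ∀ p, ∑ p', logCoeff F s u 0 p₀ p' * matN (RatFunc F) s p' p = 0 := by
        intro p
        refine Finset.sum_eq_zero fun p' _ => ?_
        rw [logCoeff, twInv_zero, Matrix.one_apply]
        split_ifs with h
        · rw [← h, matN_last_row _ hp₀, mul_zero]
        · rw [zero_mul]
      simp only [h0, zero_mul, Finset.sum_const_zero, add_zero, logDefect, sub_zero,
        logTerm, Finset.mul_sum, pow_zero, pow_one]
      exact Finset.sum_congr rfl fun p _ => by ring
    | succ n =>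
      have h0 : ∀ p, ∑ p', logCoeff F s u (n + 1) p₀ p' * matN (RatFunc F) s p' p =
          -(ι X ^ Fintype.card F ^ (n + 1) - ι X) * logCoeff F s u (n + 1) p₀ p -
          ∑ p', logCoeff F s u n p₀ p' * ι (matE s u p' p) ^ Fintype.card F ^ n := by
        intro p
        have h := logCoeff_last_row F s u hp₀ n p
        rw [bracket, map_sub, map_pow] at h
        rw [h, add_sub_cancel_right]
      simp only [h0]
      rw [logDefect, logTerm, Finset.mul_sum, ← Finset.sum_add_distrib, ← Finset.sum_sub_distrib]
      exact Finset.sum_congr rfl fun p _ => by ring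
  rw [← hmain, ← hdefect, logTerm, ← Finset.sum_add_distrib, ← Finset.sum_add_distrib]
  exact Finset.sum_congr rfl fun p _ => by rw [hrho, mul_add, mul_add]

lemma rhoT_mem {x : Coord s → F[X]} (hx : ∀ p, x p ∈ v.asIdeal) (p : Coord s) :
    rhoT s u x p ∈ v.asIdeal := by
  refine add_mem (add_mem (Ideal.mul_mem_left _ _ (hx p)) (sum_mem fun p' _ =>
    Ideal.mul_mem_left _ _ (hx p'))) (sum_mem fun p' _ => Ideal.mul_mem_left _ _
      (Ideal.pow_mem_of_mem _ (hx p') _ Fintype.card_pos))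

/-- `log_G(ρ_t(x)) = θ log_G(x)` on the last coordinate of a block. -/
lemma logSum_rhoT {p₀ : Coord s} (hp₀ : (p₀.2 : ℕ) + 1 = blockDim s p₀.1)
    {x : Coord s → F[X]} (hx : ∀ p, x p ∈ v.asIdeal) :
    logSum v s u p₀ (rhoT s u x) =
      algebraMap F[X] (v.adicCompletion (RatFunc F)) X * logSum v s u p₀ x := by
  -- After telescoping, the partial sums differ by one defect, which tends to 0.
  have hpart : ∀ n, ∑ i ∈ Finset.range n, logTerm s u p₀ (rhoT s u x) i =
      algebraMap F[X] (RatFunc F) X *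
        ∑ i ∈ Finset.range n, logTerm s u p₀ x i + logDefect s u p₀ x n := by
    intro n
    induction n with
    | zero => simp [logDefect]
    | succ n ih =>
      rw [Finset.sum_range_succ, Finset.sum_range_succ, ih, logTerm_rhoT hp₀]
      ring
  have h1 := (summable_logTerm (u := u) hp₀ (rhoT_mem (u := u) hx)).hasSum.tendsto_sum_nat
  have h2 := ((summable_logTerm (u := u) hp₀ hx).hasSum.tendsto_sum_nat.const_mul
    (algebraMap F[X] (v.adicCompletion (RatFunc F)) X)).add
      (tendsto_zero_of_le_exp _ (valuation_logDefect_le (u := u) hp₀ hx))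
  rw [add_zero] at h2
  refine tendsto_nhds_unique h1 (h2.congr fun n => ?_)
  rw [← map_sum, ← map_sum, hpart, map_add, map_mul, ← IsScalarTower.algebraMap_apply]

lemma logTerm_add (p₀ : Coord s) (x y : Coord s → F[X]) (i : ℕ) :
    logTerm s u p₀ (x + y) i = logTerm s u p₀ x i + logTerm s u p₀ y i := by
  simp only [logTerm, ← Finset.sum_add_distrib, ← mul_add, ← map_add,
    ← frobeniusAlgHom_pow_apply, Pi.add_apply]

lemma logTerm_smul (p₀ : Coord s) (c : F) (x : Coord s → F[X]) (i : ℕ) :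
    logTerm s u p₀ (c • x) i =
      algebraMap F[X] (RatFunc F) (C c) * logTerm s u p₀ x i := by
  simp only [logTerm, Finset.mul_sum]
  refine Finset.sum_congr rfl fun p _ => ?_
  rw [← map_pow, ← map_pow, ← frobeniusAlgHom_pow_apply, ← frobeniusAlgHom_pow_apply,
    Pi.smul_apply, map_smul, smul_eq_C_mul, map_mul]
  ring

lemma rho_mem (b : F[X]) {x : Coord s → F[X]} (hx : ∀ p, x p ∈ v.asIdeal) (p : Coord s) :
    rho s u b x p ∈ v.asIdeal := by
  induction b using Polynomial.induction_on generalizing p with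
  | C c =>
    rw [rho, aeval_C, Module.algebraMap_end_apply, Pi.smul_apply, smul_eq_C_mul]
    exact Ideal.mul_mem_left _ _ (hx p)
  | add b b' hb hb' =>
    rw [map_add]
    exact add_mem (hb p) (hb' p)
  | monomial n c ih =>
    rw [pow_succ', ← mul_assoc, mul_comm _ X, mul_assoc, map_mul, Module.End.mul_apply,
      show rho s u X = rhoT s u from aeval_X _]
    exact rhoT_mem ih p

/-- `log_G(ρ_b(x)) = b(θ) log_G(x)` on the last coordinate of a block. -/
lemma logSum_rho {p₀ : Coord s} (hp₀ : (p₀.2 : ℕ) + 1 = blockDim s p₀.1) (b : F[X])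
    {x : Coord s → F[X]} (hx : ∀ p, x p ∈ v.asIdeal) :
    logSum v s u p₀ (rho s u b x) =
      algebraMap F[X] (v.adicCompletion (RatFunc F)) b * logSum v s u p₀ x := by
  induction b using Polynomial.induction_on with
  | C c =>
    rw [rho, aeval_C, Module.algebraMap_end_apply, logSum]
    simp only [logTerm_smul, map_mul, ← IsScalarTower.algebraMap_apply]
    exact (summable_logTerm hp₀ hx).tsum_mul_left _
  | add b b' hb hb' =>
    rw [map_add, LinearMap.add_apply, logSum]
    simp only [logTerm_add, map_add]
    rw [(summable_logTerm hp₀ (rho_mem b hx)).tsum_add (summable_logTerm hp₀ (rho_mem b' hx)),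
      ← logSum, ← logSum, hb, hb', add_mul]
  | monomial n c ih =>
    rw [pow_succ', ← mul_assoc, mul_comm _ X, mul_assoc, map_mul, Module.End.mul_apply,
      show rho s u X = rhoT s u from aeval_X _, logSum_rhoT hp₀ (rho_mem _ hx), ih,
      map_mul _ X (C c * X ^ n), mul_assoc]

lemma logG_eq_logSum (p₀ : Coord s) (x : Coord s → F[X]) :
    logG v s u (fun p => algebraMap F[X] (v.adicCompletion (RatFunc F)) (x p)) p₀ =
      logSum v s u p₀ x := by
  simp only [logG, logSum, logTerm, map_sum, map_mul, map_pow, ← IsScalarTower.algebraMap_apply]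

end LogSeries

/-! ### The lower bound for star polylogarithms. -/

section StarLog

variable {F : Type*} [Field F] [Fintype F] (v : HeightOneSpectrum F[X]) {r : ℕ} (s : Fin r → ℕ)
  (u : Fin r → F[X])

/-- `ord_v(Li⋆_𝔰(𝐮)_v) ≥ B_{wt(𝔰),v}`. -/
lemma valued_starLi_le : Valued.v (starLi v s u) ≤ exp (-boundB v (weight s)) := by
  have hw : weight (s ∘ Fin.rev) = weight s := Equiv.sum_comp Fin.revPerm s
  rw [starLi, ← hw]
  set s' := s ∘ Fin.rev
  set u' := u ∘ Fin.rev
  have hadm := (exists_isAdmissible v s' u').choose_spec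
  set a := (exists_isAdmissible v s' u').choose
  obtain ⟨b, hb, hbv⟩ := exists_isAdmissible_notMem v s' u'
  have ha0 : Valued.v (algebraMap F[X] (v.adicCompletion (RatFunc F)) a) ≠ 0 := by
    rw [valued_algebraMap]
    exact v.intValuation_ne_zero _ hadm.1
  have hb1 : Valued.v (algebraMap F[X] (v.adicCompletion (RatFunc F)) b) = 1 :=
    le_antisymm (valued_algebraMap_le_one v b)
      (not_lt.1 fun h => hbv ((valued_algebraMap_lt_one_iff v b).1 h))
  have hterm : ∀ p₀ : Coord s', (p₀.2 : ℕ) + 1 = blockDim s' p₀.1 →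
      Valued.v (logG v s' u' (fun p' => algebraMap F[X] (v.adicCompletion (RatFunc F))
        (rho s' u' a (specialPoint s' u') p')) p₀) ≤
      Valued.v (algebraMap F[X] (v.adicCompletion (RatFunc F)) a) *
        exp (-boundB v (weight s')) := by
    intro p₀ hp₀
    have hxa := fun p => (valued_algebraMap_lt_one_iff v _).1 (hadm.2 p)
    have hxb := fun p => (valued_algebraMap_lt_one_iff v _).1 (hb.2 p)
    have h1 := logSum_rho (u := u') hp₀ b hxa
    have h2 := logSum_rho (u := u') hp₀ a hxb
    -- Both expressions are the logarithm at ρ_{ab}(𝐯), so a(θ) log ρ_b(𝐯) = b(θ) log ρ_a(𝐯). As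
    -- b(θ) is a v-adic unit, the logarithm at ρ_a(𝐯) gains the full order of a(θ), which cancels
    -- the denominator in Li⋆.
    rw [← Module.End.mul_apply, ← map_mul, mul_comm, map_mul, Module.End.mul_apply, h2] at h1
    have h3 := congrArg Valued.v h1
    rw [map_mul, map_mul, hb1, one_mul] at h3
    rw [logG_eq_logSum, ← h3]
    gcongr
    exact valued_logSum_le hp₀ hxb
  rw [map_mul, map_div₀, map_pow, Valuation.map_neg, map_one, one_pow]
  refine (mul_le_mul_right (Valued.v.map_sum_le fun p hp =>
    hterm p (Finset.mem_filter.1 hp).2.2) _).trans_eq ?_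
  rw [← mul_assoc, one_div, inv_mul_cancel₀ ha0, one_mul]

end StarLog

/-! ### Assembling the bound, integrality, and the exceptional places. -/

section MZV

variable {F : Type*} [Field F] [Fintype F] (v : HeightOneSpectrum F[X])

/-- All indices 𝐰(𝔰) have the weight of 𝔰, so one constant B_{wt,v} serves for every polylogarithm
in the definition. -/
lemma sum_map_fst_merge {R : Type*} [Mul R] (w : List Bool) (l : List (ℕ × R)) :
    ((merge w l).map Prod.fst).sum = (l.map Prod.fst).sum := by
  induction w, l using merge.induct with
  | case1 w x l ih => simp [merge, ih]
  | case2 w x y l ih => rw [merge, ih]; simp [add_assoc]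
  | case3 w l h1 h2 =>
    rw [merge]
    · exact h1
    · exact h2

variable {r : ℕ} (s : Fin r → ℕ)

/-- The loss from Γ_𝔰 is kept as an integer g: the rational bound follows by division, and for large
q_v integrality of g forces g = 0. -/
lemma valued_vadicMZV_le (hs : ∀ i, 0 < s i) : ∃ g : ℕ,
    (g : ℤ) * (qv v - 1) ≤ weight s - r - height s ∧
      Valued.v (vadicMZV v s) ≤ exp (g - boundB v (weight s)) := by
  obtain ⟨g, hg, hle⟩ := exists_exp_le_valuation_carlitzGammaIndex v s hs
  refine ⟨g, hle, ?_⟩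
  rw [vadicMZV, map_mul, map_inv₀, valued_algebraMap, sub_eq_add_neg, exp_add]
  refine mul_le_mul' ?_ (Valued.v.map_sum_le fun j _ => Valued.v.map_sum_le fun w _ => ?_)
  · rw [exp_neg] at hg
    exact inv_le_of_inv_le₀ exp_pos hg
  · dsimp only
    set L := merge (List.ofFn w)
      (List.ofFn fun i => (s i, (andersonThakur F (s i - 1)).coeff (j i))) with hL
    have hw : weight (fun i => (L.get i).1) = weight s := by
      have h := sum_map_fst_merge (List.ofFn w)
        (List.ofFn fun i => (s i, (andersonThakur F (s i - 1)).coeff (j i)))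
      rw [← hL, List.map_ofFn, List.sum_ofFn] at h
      refine Eq.trans ?_ h
      rw [weight, ← List.sum_ofFn]
      congr 1
      exact List.map_ofFn.symm.trans (congrArg _ (List.ofFn_get L))
    have h1 := valued_starLi_le v (fun i => (L.get i).1) (fun i => (L.get i).2)
    rw [hw] at h1
    rw [map_mul, map_mul]
    refine (mul_le_mul' (mul_le_one' (valued_algebraMap_le_one v _) ?_) h1).trans_eq (one_mul _)
    rw [map_pow, Valuation.map_neg, map_one, one_pow]

lemma le_ordv_vadicMZV (hs : ∀ i, 0 < s i) :
    (((boundB v (weight s) : ℚ) - ((weight s : ℚ) - r - height s) / ((qv v : ℚ) - 1) : ℚ) :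
      WithTop ℚ) ≤ ordv v (vadicMZV v s) := by
  obtain ⟨g, hg, hle⟩ := valued_vadicMZV_le v s hs
  rw [ordv]
  split_ifs with h0
  · exact le_top
  · rw [WithTop.coe_le_coe]
    have h1 := (log_le_iff_le_exp ((_root_.map_ne_zero _).2 h0)).2 hle
    have hq : (0 : ℚ) < (qv v : ℚ) - 1 := by
      have := two_le_qv v
      rw [sub_pos]
      exact_mod_cast this
    have h2 : (g : ℚ) ≤ ((weight s : ℚ) - r - height s) / ((qv v : ℚ) - 1) := by
      rw [le_div_iff₀ hq]
      exact_mod_cast hg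
    have h3 : (boundB v (weight s) : ℚ) - g ≤
        ((-(log (Valued.v (vadicMZV v s))) : ℤ) : ℚ) := by
      have : boundB v (weight s) - g ≤ -(log (Valued.v (vadicMZV v s))) := by omega
      exact_mod_cast this
    linarith

/-- For n ≥ 0, multiply n + 1 ≤ 2^n ≤ q_v^n by w ≤ q_v; the remaining exponent 0 gives the value 1.
-/
lemma boundB_nonneg {w : ℕ} (hw : w ≤ qv v) : 0 ≤ boundB v w := by
  obtain ⟨n, hn⟩ := (isLeast_boundB v w).1
  rw [← hn, sub_nonneg]
  have h2 := two_le_qv v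
  rcases n with _ | n
  · simp
  have h1 : n + 1 ≤ qv v ^ n :=
    (Nat.succ_le_of_lt n.lt_two_pow_self).trans (Nat.pow_le_pow_left h2 n)
  have h3 := Nat.mul_le_mul h1 hw
  rw [← pow_succ] at h3
  exact_mod_cast h3

lemma vadicMZV_mem_of_weight_le_qv (hr : 0 < r) (hs : ∀ i, 0 < s i) (hw : weight s ≤ qv v) :
    vadicMZV v s ∈ v.adicCompletionIntegers (RatFunc F) := by
  obtain ⟨g, hg, hle⟩ := valued_vadicMZV_le v s hs
  have hB := boundB_nonneg v hw
  have hq := two_le_qv v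
  -- If g ≥ 1, then q_v - 1 ≤ wt - r - ht with wt ≤ q_v and r ≥ 1 forces ht = 0. All s_i are then 1,
  -- so wt = r and the right side is 0, contradicting q_v ≥ 2.
  have hg0 : g = 0 := by
    by_contra hne
    have h1 : (1 : ℤ) * (qv v - 1) ≤ g * (qv v - 1) :=
      mul_le_mul_of_nonneg_right (by omega) (by omega)
    have h2 : height s = 0 := by omega
    have h3 : ∀ i, s i = 1 := by
      simpa [height, Finset.filter_eq_empty_iff] using h2
    have h4 : weight s = r := by simp [weight, h3]
    omega
  rw [HeightOneSpectrum.mem_adicCompletionIntegers]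
  refine hle.trans ?_
  rw [← exp_zero, exp_le_exp, hg0]
  push_cast
  omega

/-- Such a v has degree d < q^d = q_v < w and divides [d], hence divides the fixed nonzero product
[1]⋯[w]. -/
lemma finite_setOf_qv_lt (w : ℕ) : {v : HeightOneSpectrum F[X] | qv v < w}.Finite := by
  have hne : ∀ n, (∏ i ∈ Finset.range n, bracket F (i + 1)) ≠ 0 := fun n =>
    Finset.prod_ne_zero_iff.2 fun i _ => bracket_ne_zero F i
  refine (Ideal.finite_factors (I := Ideal.span {∏ i ∈ Finset.range w, bracket F (i + 1)})
    (by simpa [Ideal.zero_eq_bot] using hne w)).subset fun v hv => ?_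
  change v.asIdeal ∣ _
  rw [Ideal.dvd_span_singleton]
  have hd := placeDegree_pos v
  have hdw : placeDegree v < w := by
    refine lt_of_lt_of_le ?_ (le_of_lt hv)
    rw [qv_eq]
    exact Nat.lt_pow_self (one_lt_q F)
  refine Ideal.mem_of_dvd _ (Finset.dvd_prod_of_mem _
    (Finset.mem_range.2 (show placeDegree v - 1 < w by omega))) ?_
  rw [bracket_mem_iff, Nat.sub_add_cancel hd]

end MZV
end VadicMZV

theorem theorem4p2 (F : Type*) [Field F] [Fintype F] {r : ℕ} (hr : 0 < r) (s : Fin r → ℕ)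
    (hs : ∀ i, 0 < s i) :
    (∀ v : HeightOneSpectrum F[X],
      (((VadicMZV.boundB v (VadicMZV.weight s) : ℚ) -
        ((VadicMZV.weight s : ℚ) - r - VadicMZV.height s) / ((VadicMZV.qv v : ℚ) - 1) : ℚ) :
          WithTop ℚ) ≤ VadicMZV.ordv v (VadicMZV.vadicMZV v s)) ∧
    (∀ v : HeightOneSpectrum F[X], VadicMZV.weight s ≤ VadicMZV.qv v →
      VadicMZV.vadicMZV v s ∈ v.adicCompletionIntegers (RatFunc F)) ∧
    {v : HeightOneSpectrum F[X] |
      VadicMZV.vadicMZV v s ∉ v.adicCompletionIntegers (RatFunc F)}.Finite :=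
  ⟨fun v => VadicMZV.le_ordv_vadicMZV v s hs,
    fun v hv => VadicMZV.vadicMZV_mem_of_weight_le_qv v s hr hs hv,
    (VadicMZV.finite_setOf_qv_lt (VadicMZV.weight s)).subset fun v hv =>
      not_le.1 fun h => hv (VadicMZV.vadicMZV_mem_of_weight_le_qv v s hr hs h)⟩
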